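/- Let $\lambda\in\mathbb C$ with $|\lambda|>1$, and let $\varphi\in\mathrm{Diff}^\infty([0,\infty))$ be expanding, i.e. $\varphi(x)>x$ for all $x>0$. Let $\tilde R=(\mathbb C\times[0,\infty))\setminus\{(0,0)\}$, foliated by the complex leaves $\mathbb C\times\{x\}$ ($x>0$) and $\mathbb C^*\times\{0\}$, let $T(z,x)=(\lambda z,\varphi(x))$, and let $R=\tilde R/T^{\mathbb Z}$ be the $3$-dimensional Reeb component with complex leaves obtained as the quotient (the Hopf construction). For a foliation with complex leaves, $\mathrm{Aut}$ denotes the group of all smooth diffeomorphisms that preserve the foliation and are holomorphic along the leaves. Let $\mathrm{Aut}(\tilde R;T)$ be the centralizer of $T$ in $\mathrm{Aut}\,\tilde R$, let $Z_\varphi$ be the centralizer of $\varphi$ in $\mathrm{Diff}^\infty([0,\infty))$, and let $$\mathcal K_{\lambda,\varphi}=\{b\in C^\infty([0,\infty),\mathbb C)\;:\; b(\varphi(x))=\lambda b(x)\ \text{ for all }x\ge 0\},$$ an additive group. (i) Passing to the quotient induces an isomorphism $\mathrm{Aut}(\tilde R;T)/T^{\mathbb Z}\cong\mathrm{Aut}\,R$.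 (ii) There is a well-defined action by automorphisms of the group $(\mathbb C^*\times Z_\varphi)/(\lambda,\varphi)^{\mathbb Z}$ on $\mathcal K_{\lambda,\varphi}$, in which the class of $(a,\eta)$ acts by $b\mapsto a^{-1}\,(b\circ\eta)$; thus $a\in\mathbb C^*$ acts by $b\mapsto a^{-1}b$ and $\eta\in Z_\varphi$ by $b\mapsto b\circ\eta$. (iii) $\mathrm{Aut}\,R$ is isomorphic to the semidirect product $$\mathcal K_{\lambda,\varphi}\rtimes\left\{(\mathbb C^*\times Z_\varphi)/(\lambda,\varphi)^{\mathbb Z}\right\}$$ for this action. The isomorphism can be chosen so that, under the identification (i), the class of $(z,x)\mapsto(z+b(x),x)$ corresponds to $b\in\mathcal K_{\lambda,\varphi}$, and the class of $(z,x)\mapsto(az,\eta(x))$ corresponds to the inverse of the class of $(a,\eta)$. -/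

import Mathlib

open Set Topology
open scoped NNReal ContDiff Manifold

noncomputable section

/-! ### Foliations with complex leaves of complex dimension one and real codimension one -/

/-- The local model `ℂ × [0, ∞)` of a `3`-manifold with boundary, foliated by the slices
`ℂ × {x}`, which carry the standard complex structure. -/
abbrev LeafModel : Type := ℂ × ℝ≥0

namespace LeafModel

/-- The inclusion of `ℂ × [0, ∞)` in the vector space `ℂ × ℝ`. -/
def incl (p : LeafModel) : ℂ × ℝ := (p.1, (p.2 : ℝ))

/-- A retraction of `ℂ × ℝ` onto `ℂ × [0, ∞)`, used only to extend functions arbitrarily. -/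
def retr (p : ℂ × ℝ) : LeafModel := (p.1, p.2.toNNReal)

theorem retr_incl (p : LeafModel) : retr (incl p) = p := by
  simp [retr, incl]

theorem continuous_retr : Continuous retr := by
  unfold retr
  fun_prop

theorem continuous_incl : Continuous incl := by
  unfold incl
  fun_prop

/-- A map `f (z, x) = (w, t)` on the open set `s` of `ℂ × [0, ∞)` is a leafwise holomorphic
foliated map if it is smooth (up to the boundary), `t` depends locally only on `x`, and `w` is
holomorphic in `z` when `x` is fixed. -/
structure IsLeafwise (f : LeafModel → LeafModel) (s : Set LeafModel) : Prop where
  smooth : ContDiffOn ℝ ∞ (incl ∘ f ∘ retr) (incl '' s)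
  foliated : ∀ p ∈ s, ∃ v : Set LeafModel, IsOpen v ∧ p ∈ v ∧
    ∀ q ∈ s ∩ v, ∀ q' ∈ s ∩ v, q.2 = q'.2 → (f q).2 = (f q').2
  holomorphic : ∀ p ∈ s, DifferentiableAt ℂ (fun z : ℂ => (f (z, p.2)).1) p.1

theorem IsLeafwise.mono {f : LeafModel → LeafModel} {s t : Set LeafModel}
    (h : IsLeafwise f s) (hts : t ⊆ s) : IsLeafwise f t where
  smooth := h.smooth.mono (image_mono hts)
  foliated p hp := by
    obtain ⟨v, hv, hpv, H⟩ := h.foliated p (hts hp)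
    exact ⟨v, hv, hpv, fun q hq q' hq' => H q ⟨hts hq.1, hq.2⟩ q' ⟨hts hq'.1, hq'.2⟩⟩
  holomorphic p hp := h.holomorphic p (hts hp)

theorem IsLeafwise.congr {f g : LeafModel → LeafModel} {s : Set LeafModel} (hs : IsOpen s)
    (hfg : ∀ p ∈ s, g p = f p) (h : IsLeafwise f s) : IsLeafwise g s where
  smooth := by
    refine h.smooth.congr ?_
    rintro _ ⟨p, hp, rfl⟩
    simp [retr_incl, hfg p hp]
  foliated p hp := by
    obtain ⟨v, hv, hpv, H⟩ := h.foliated p hp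
    refine ⟨v, hv, hpv, fun q hq q' hq' hqq => ?_⟩
    rw [hfg q hq.1, hfg q' hq'.1]
    exact H q hq q' hq' hqq
  holomorphic p hp := by
    refine (h.holomorphic p hp).congr_of_eventuallyEq ?_
    have hc : Continuous fun z : ℂ => ((z, p.2) : LeafModel) := by fun_prop
    filter_upwards [(hs.preimage hc).mem_nhds (show p.1 ∈ _ from hp)] with z hz
    rw [hfg _ hz]

/-- The pseudogroup of leafwise holomorphic foliated maps. -/
def pregroupoid : Pregroupoid LeafModel where
  property := IsLeafwise
  comp := by
    intro f g u v hf hg hu hv huv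
    have hfc : ∀ p ∈ u, ContinuousAt f p := by
      intro p hp
      have h1 : ContinuousOn (incl ∘ f ∘ retr) (incl '' u) := hf.smooth.continuousOn
      have h2 : ContinuousOn (retr ∘ (incl ∘ f ∘ retr) ∘ incl) u :=
        continuous_retr.comp_continuousOn
          (h1.comp continuous_incl.continuousOn (mapsTo_image _ _))
      have h3 : retr ∘ (incl ∘ f ∘ retr) ∘ incl = f := by
        funext q
        simp [retr_incl]
      rw [h3] at h2
      exact h2.continuousAt (hu.mem_nhds hp)
    refine ⟨?_, ?_, ?_⟩
    · have h1 : incl ∘ (g ∘ f) ∘ retr = (incl ∘ g ∘ retr) ∘ (incl ∘ f ∘ retr) := by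
        funext q
        simp [retr_incl]
      rw [h1]
      refine hg.smooth.comp (hf.smooth.mono (image_mono inter_subset_left)) ?_
      rintro _ ⟨p, hp, rfl⟩
      exact ⟨f p, hp.2, by simp [retr_incl]⟩
    · rintro p ⟨hp, hfp⟩
      obtain ⟨v₁, hv₁, hpv₁, H₁⟩ := hf.foliated p hp
      obtain ⟨v₂, hv₂, hpv₂, H₂⟩ := hg.foliated (f p) hfp
      obtain ⟨w, hw, hwo, hpw⟩ := mem_nhds_iff.1 ((hfc p hp).preimage_mem_nhds (hv₂.mem_nhds hpv₂))
      refine ⟨v₁ ∩ w, hv₁.inter hwo, ⟨hpv₁, hpw⟩, ?_⟩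
      rintro q ⟨⟨hq, hfq⟩, hq₁, hq₂⟩ q' ⟨⟨hq', hfq'⟩, hq₁', hq₂'⟩ hqq
      exact H₂ _ ⟨hfq, hw hq₂⟩ _ ⟨hfq', hw hq₂'⟩ (H₁ _ ⟨hq, hq₁⟩ _ ⟨hq', hq₁'⟩ hqq)
    · rintro p ⟨hp, hfp⟩
      obtain ⟨v₁, hv₁, hpv₁, H₁⟩ := hf.foliated p hp
      have hc : Continuous fun z : ℂ => ((z, p.2) : LeafModel) := by fun_prop
      have h1 : DifferentiableAt ℂ
          ((fun w : ℂ => (g (w, (f p).2)).1) ∘ fun z : ℂ => (f (z, p.2)).1) p.1 :=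
        DifferentiableAt.comp p.1 (hg.holomorphic (f p) hfp) (hf.holomorphic p hp)
      refine h1.congr_of_eventuallyEq ?_
      filter_upwards [((hu.inter hv₁).preimage hc).mem_nhds
        (show p.1 ∈ _ from ⟨hp, hpv₁⟩)] with z hz
      have h2 : (f (z, p.2)).2 = (f p).2 := H₁ _ hz _ ⟨hp, hpv₁⟩ rfl
      simp only [Function.comp_apply]
      rw [← h2]
  id_mem := by
    refine ⟨?_, fun p _ => ⟨univ, isOpen_univ, mem_univ p, fun q _ q' _ h => h⟩, fun p _ => ?_⟩
    · refine contDiffOn_id.congr ?_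
      rintro _ ⟨p, -, rfl⟩
      simp [retr_incl]
    · exact differentiableAt_id
  locality := by
    intro f u hu H
    refine ⟨?_, ?_, ?_⟩
    · rintro _ ⟨p, hp, rfl⟩
      obtain ⟨v, hv, hpv, h⟩ := H p hp
      refine (h.smooth (incl p) ⟨p, ⟨hp, hpv⟩, rfl⟩).mono_of_mem_nhdsWithin ?_
      have h1 : retr ⁻¹' v ∈ 𝓝 (incl p) :=
        continuous_retr.continuousAt.preimage_mem_nhds (by rw [retr_incl]; exact hv.mem_nhds hpv)
      filter_upwards [self_mem_nhdsWithin, mem_nhdsWithin_of_mem_nhds h1]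
      rintro _ ⟨q, hq, rfl⟩ hqv
      exact ⟨q, ⟨hq, by simpa [retr_incl] using hqv⟩, rfl⟩
    · intro p hp
      obtain ⟨v, hv, hpv, h⟩ := H p hp
      obtain ⟨w, hw, hpw, h'⟩ := h.foliated p ⟨hp, hpv⟩
      refine ⟨v ∩ w, hv.inter hw, ⟨hpv, hpw⟩, fun q hq q' hq' => ?_⟩
      exact h' q ⟨⟨hq.1, hq.2.1⟩, hq.2.2⟩ q' ⟨⟨hq'.1, hq'.2.1⟩, hq'.2.2⟩
    · intro p hp
      obtain ⟨v, hv, hpv, h⟩ := H p hp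
      exact h.holomorphic p ⟨hp, hpv⟩
  congr := by
    intro f g u hu hfg h
    exact h.congr hu hfg

/-- The groupoid of leafwise biholomorphic foliated local diffeomorphisms of `ℂ × [0, ∞)`: the
admissible coordinate changes of a foliation with complex leaves. A space `M` with
`ChartedSpace LeafModel M` and `HasGroupoid M LeafModel.groupoid` is a `3`-manifold with boundary,
with a foliation by complex curves that is tangent to the boundary. -/
def groupoid : StructureGroupoid LeafModel := pregroupoid.groupoid

instance : ClosedUnderRestriction groupoid where
  closedUnderRestriction := by
    intro e he s hs
    refine ⟨he.1.mono ?_, he.2.mono ?_⟩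
    · intro p hp
      exact hp.1
    · intro p hp
      exact hp.1

end LeafModel

/-- The group of automorphisms of a foliation with complex leaves: the homeomorphisms that, read
in the foliated charts, are smooth with smooth inverse, preserve the foliation and are holomorphic
along the leaves. -/
def leafAut (M : Type) [TopologicalSpace M] [ChartedSpace LeafModel M]
    [HasGroupoid M LeafModel.groupoid] : Subgroup (M ≃ₜ M) where
  carrier := {f | ∀ c ∈ atlas LeafModel M, ∀ c' ∈ atlas LeafModel M,
    c.symm ≫ₕ f.toOpenPartialHomeomorph ≫ₕ c' ∈ LeafModel.groupoid}
  one_mem' := fun c hc c' hc' =>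
    (Structomorph.refl (G := LeafModel.groupoid) M).mem_groupoid c c' hc hc'
  mul_mem' := by
    intro f g hf hg c hc c' hc'
    exact (Structomorph.trans
      (⟨g, fun c c' hc hc' => hg c hc c' hc'⟩ : Structomorph LeafModel.groupoid M M)
      ⟨f, fun c c' hc hc' => hf c hc c' hc'⟩).mem_groupoid c c' hc hc'
  inv_mem' := by
    intro f hf c hc c' hc'
    exact (Structomorph.symm
      (⟨f, fun c c' hc hc' => hf c hc c' hc'⟩ : Structomorph LeafModel.groupoid M M)).mem_groupoid
        c c' hc hc'

/-! ### Diffeomorphisms of the half line -/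

/-- Smoothness on `[0, ∞)`, up to the boundary point. -/
def SmoothHalf {E : Type} [NormedAddCommGroup E] [NormedSpace ℝ E] (f : ℝ≥0 → E) : Prop :=
  ContDiffOn ℝ ∞ (fun x : ℝ => f x.toNNReal) (Ici 0)

theorem SmoothHalf.comp {E : Type} [NormedAddCommGroup E] [NormedSpace ℝ E] {f : ℝ≥0 → E}
    {g : ℝ≥0 → ℝ≥0} (hf : SmoothHalf f) (hg : SmoothHalf fun x => (g x : ℝ)) :
    SmoothHalf fun x => f (g x) := by
  have h : ContDiffOn ℝ ∞ ((fun x : ℝ => f x.toNNReal) ∘ fun x : ℝ => (g x.toNNReal : ℝ)) (Ici 0) :=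
    ContDiffOn.comp hf hg fun x _ => (g x.toNNReal).2
  refine h.congr fun x _ => ?_
  simp

theorem smoothHalf_id : SmoothHalf fun x : ℝ≥0 => (x : ℝ) :=
  contDiffOn_id.congr fun x hx => Real.coe_toNNReal x hx

/-- The group `Diff^∞([0, ∞))`. -/
def DiffHalf : Subgroup (ℝ≥0 ≃ₜ ℝ≥0) where
  carrier := {f | (SmoothHalf fun x => (f x : ℝ)) ∧ SmoothHalf fun x => (f.symm x : ℝ)}
  one_mem' := ⟨smoothHalf_id, smoothHalf_id⟩
  mul_mem' := by
    intro f g hf hg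
    exact ⟨hf.1.comp hg.1, hg.2.comp hf.2⟩
  inv_mem' := fun hf => ⟨hf.2, hf.1⟩

theorem Homeomorph.nnreal_map_zero (f : ℝ≥0 ≃ₜ ℝ≥0) : f 0 = 0 := by
  rcases f.continuous.strictMono_of_inj f.injective with h | h
  · obtain ⟨y, hy⟩ := f.surjective 0
    have := h.monotone (zero_le (a := y))
    rw [hy] at this
    exact le_antisymm this zero_le
  · obtain ⟨y, hy⟩ := f.surjective (f 0 + 1)
    have := h.antitone (zero_le (a := y))
    rw [hy] at this
    exact absurd this (not_le.2 (lt_add_of_pos_right _ one_pos))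

/-! ### The Hopf construction -/

/-- The manifold `R̃ = ℂ × [0, ∞) ∖ {(0, 0)}`, as an open subset of `ℂ × [0, ∞)`. -/
def hopfCover : TopologicalSpace.Opens LeafModel := ⟨{0}ᶜ, isOpen_compl_singleton⟩

instance : Nonempty hopfCover := ⟨⟨(1, 0), by simp [hopfCover]⟩⟩

/-- The homeomorphism `(z, x) ↦ (a z, η x)` of `R̃`, as a function of `(a, η)`. -/
def hopfProd : ℂˣ × DiffHalf →* (hopfCover ≃ₜ hopfCover) where
  toFun g :=
    { toFun := fun p => ⟨((g.1 : ℂ) * p.1.1, (g.2 : ℝ≥0 ≃ₜ ℝ≥0) p.1.2), by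
        intro h
        apply p.2
        rw [mem_singleton_iff, Prod.ext_iff] at h ⊢
        refine ⟨by simpa using h.1, (g.2 : ℝ≥0 ≃ₜ ℝ≥0).injective ?_⟩
        rw [Prod.snd_zero, Homeomorph.nnreal_map_zero]
        exact h.2⟩
      invFun := fun p => ⟨((g.1⁻¹ : ℂˣ) * p.1.1, (g.2 : ℝ≥0 ≃ₜ ℝ≥0).symm p.1.2), by
        intro h
        apply p.2
        rw [mem_singleton_iff, Prod.ext_iff] at h ⊢
        refine ⟨by simpa using h.1, (g.2 : ℝ≥0 ≃ₜ ℝ≥0).symm.injective ?_⟩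
        rw [Prod.snd_zero, Homeomorph.nnreal_map_zero]
        exact h.2⟩
      left_inv := fun p => by simp
      right_inv := fun p => by simp
      continuous_toFun := by fun_prop
      continuous_invFun := by fun_prop }
  map_one' := by
    ext p <;> simp
  map_mul' g h := by
    ext p <;> simp [mul_assoc]

theorem hopfProd_apply (g : ℂˣ × DiffHalf) (p : hopfCover) :
    (hopfProd g p : LeafModel) = ((g.1 : ℂ) * p.1.1, (g.2 : ℝ≥0 ≃ₜ ℝ≥0) p.1.2) := rfl

theorem isLeafwise_prod (g : ℂˣ × DiffHalf) (s : Set LeafModel) :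
    LeafModel.IsLeafwise (fun p => ((g.1 : ℂ) * p.1, (g.2 : ℝ≥0 ≃ₜ ℝ≥0) p.2)) s where
  smooth := by
    refine ContDiffOn.prodMk ?_ ?_
    · exact (contDiff_const.mul contDiff_fst).contDiffOn
    · refine ContDiffOn.comp (t := Ici 0) (g := fun x : ℝ => ((g.2 : ℝ≥0 ≃ₜ ℝ≥0) x.toNNReal : ℝ))
        g.2.2.1 contDiff_snd.contDiffOn ?_
      rintro _ ⟨p, -, rfl⟩
      exact p.2.2
  foliated p _ := ⟨univ, isOpen_univ, mem_univ p, fun q _ q' _ h => by simp [h]⟩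
  holomorphic p _ := by fun_prop

theorem hopfProd_mem (g : ℂˣ × DiffHalf) : hopfProd g ∈ leafAut hopfCover := by
  have key : ∀ g : ℂˣ × DiffHalf, ∀ c ∈ atlas LeafModel hopfCover,
      ∀ c' ∈ atlas LeafModel hopfCover, LeafModel.IsLeafwise
        (c.symm ≫ₕ (hopfProd g).toOpenPartialHomeomorph ≫ₕ c')
        (c.symm ≫ₕ (hopfProd g).toOpenPartialHomeomorph ≫ₕ c').source := by
    intro g c hc c' hc'
    refine (isLeafwise_prod g _).congr (OpenPartialHomeomorph.open_source _) fun p hp => ?_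
    obtain ⟨x, rfl⟩ := TopologicalSpace.Opens.chart_eq' inferInstance hc
    obtain ⟨x', rfl⟩ := TopologicalSpace.Opens.chart_eq' inferInstance hc'
    have hp' := ((chartAt LeafModel (x : LeafModel)).subtypeRestr (s := hopfCover)
      inferInstance).right_inv hp.1
    simp only [chartAt_self_eq, OpenPartialHomeomorph.subtypeRestr_coe, domRestrict_apply,
      OpenPartialHomeomorph.refl_apply] at hp'
    simp only [OpenPartialHomeomorph.coe_trans, Function.comp_apply, chartAt_self_eq,
      OpenPartialHomeomorph.subtypeRestr_coe, domRestrict_apply,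
      OpenPartialHomeomorph.refl_apply, Homeomorph.toOpenPartialHomeomorph_apply,
      hopfProd_apply]
    rw [id_eq] at hp' ⊢
    rw [hp']
  intro c hc c' hc'
  refine ⟨key g c hc c' hc', ?_⟩
  have h := key g⁻¹ c' hc' c hc
  rw [map_inv] at h
  have h2 : (c.symm ≫ₕ (hopfProd g).toOpenPartialHomeomorph ≫ₕ c').symm =
      c'.symm ≫ₕ ((hopfProd g)⁻¹).toOpenPartialHomeomorph ≫ₕ c := by
    rw [OpenPartialHomeomorph.trans_symm_eq_symm_trans_symm,
      OpenPartialHomeomorph.trans_symm_eq_symm_trans_symm, OpenPartialHomeomorph.symm_symm,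
      OpenPartialHomeomorph.trans_assoc]
    rfl
  rw [← h2] at h
  exact h

/-- The data `(λ, φ)` of the Hopf construction: `|λ| > 1` and `φ ∈ Diff^∞([0, ∞))` is expanding. -/
structure HopfData where
  lam : ℂˣ
  one_lt_norm : 1 < ‖(lam : ℂ)‖
  phi : DiffHalf
  expanding : ∀ x : ℝ≥0, 0 < x → x < (phi : ℝ≥0 ≃ₜ ℝ≥0) x

namespace HopfData

variable (D : HopfData)

/-- The automorphism `T (z, x) = (λ z, φ x)` of `R̃`. -/
def T : leafAut hopfCover := ⟨hopfProd (D.lam, D.phi), hopfProd_mem _⟩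

/-- The orbit relation of the group `T^ℤ` on `R̃`. -/
def orbitSetoid : Setoid hopfCover where
  r p q := ∃ n : ℤ, (D.T ^ n : leafAut hopfCover).1 p = q
  iseqv :=
    { refl := fun p => ⟨0, by simp⟩
      symm := by
        rintro p _ ⟨n, rfl⟩
        refine ⟨-n, ?_⟩
        rw [← Homeomorph.mul_apply, ← Subgroup.coe_mul, ← zpow_add]
        simp
      trans := by
        rintro p _ _ ⟨n, rfl⟩ ⟨m, rfl⟩
        refine ⟨m + n, ?_⟩
        rw [zpow_add, Subgroup.coe_mul, Homeomorph.mul_apply] }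

/-- The Reeb component `R = R̃ / T^ℤ`. -/
def Reeb : Type := Quotient D.orbitSetoid

instance : TopologicalSpace D.Reeb := inferInstanceAs (TopologicalSpace (Quotient D.orbitSetoid))

/-- The projection `R̃ → R`. -/
def proj (p : hopfCover) : D.Reeb := Quotient.mk D.orbitSetoid p

theorem proj_eq_iff {p q : hopfCover} :
    D.proj p = D.proj q ↔ ∃ n : ℤ, (D.T ^ n : leafAut hopfCover).1 p = q :=
  Quotient.eq (r := D.orbitSetoid)

theorem T_zpow (n : ℤ) : (D.T ^ n : leafAut hopfCover).1 = hopfProd ((D.lam, D.phi) ^ n) := by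
  rw [map_zpow]
  rfl

/-- A continuous function on `R̃` which is increased by `T`. -/
def height (p : hopfCover) : ℝ := ‖p.1.1‖ + (p.1.2 : ℝ)

theorem continuous_height : Continuous height := by
  unfold height
  fun_prop

theorem height_lt (p : hopfCover) : height p < height (D.T.1 p) := by
  have h1 : (D.T.1 p).1 = ((D.lam : ℂ) * p.1.1, (D.phi : ℝ≥0 ≃ₜ ℝ≥0) p.1.2) := rfl
  unfold height
  rw [h1]
  simp only [norm_mul]
  have hl := D.one_lt_norm
  by_cases hx : p.1.2 = 0
  · have hz : p.1.1 ≠ 0 := fun hz => p.2 (Prod.ext hz hx)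
    have : 0 < ‖p.1.1‖ := norm_pos_iff.2 hz
    rw [hx, Homeomorph.nnreal_map_zero]
    nlinarith
  · have h2 : (p.1.2 : ℝ) < (D.phi : ℝ≥0 ≃ₜ ℝ≥0) p.1.2 := by
      exact_mod_cast D.expanding _ (pos_iff_ne_zero.2 hx)
    have : 0 ≤ ‖p.1.1‖ := norm_nonneg _
    nlinarith

theorem height_pow (p : hopfCover) (n : ℕ) :
    height (D.T.1 p) ≤ height ((D.T ^ ((n : ℤ) + 1) : leafAut hopfCover).1 p) := by
  induction n with
  | zero => simp
  | succ k ih =>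
    refine ih.trans ?_
    have : (D.T ^ (((k + 1 : ℕ) : ℤ) + 1) : leafAut hopfCover) = D.T * D.T ^ ((k : ℤ) + 1) := by
      rw [← zpow_one_add]
      congr 1
      push_cast
      ring
    rw [this, Subgroup.coe_mul, Homeomorph.mul_apply]
    exact (D.height_lt _).le

/-- Every point of `R̃` has a neighbourhood that is disjoint from its translates. -/
theorem exists_wandering (p : hopfCover) : ∃ U : Set hopfCover, IsOpen U ∧ p ∈ U ∧
    ∀ q ∈ U, ∀ n : ℤ, (D.T ^ n : leafAut hopfCover).1 q ∈ U → n = 0 := by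
  obtain ⟨m, hm₁, hm₂⟩ := exists_between (D.height_lt p)
  let U : Set hopfCover := {q | height q < m ∧ m < height (D.T.1 q)}
  have pos : ∀ q ∈ U, ∀ n : ℕ, (D.T ^ ((n : ℤ) + 1) : leafAut hopfCover).1 q ∉ U := by
    intro q hq n hn
    exact absurd (hq.2.trans_le (D.height_pow q n)) (not_lt.2 hn.1.le)
  refine ⟨U, ?_, ⟨hm₁, hm₂⟩, ?_⟩
  · exact (isOpen_lt continuous_height continuous_const).inter
      (isOpen_lt continuous_const (continuous_height.comp D.T.1.continuous))
  · intro q hq n hn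
    rcases lt_trichotomy n 0 with h | h | h
    · exfalso
      obtain ⟨k, hk⟩ := Int.eq_ofNat_of_zero_le (show 0 ≤ -n - 1 by omega)
      refine pos _ hn k ?_
      rw [← hk, ← Homeomorph.mul_apply, ← Subgroup.coe_mul, ← zpow_add]
      simpa using hq
    · exact h
    · exfalso
      obtain ⟨k, hk⟩ := Int.eq_ofNat_of_zero_le (show 0 ≤ n - 1 by omega)
      refine pos q hq k ?_
      rw [← hk]
      simpa using hn

theorem continuous_proj : Continuous D.proj := continuous_quot_mk

theorem isOpenMap_proj : IsOpenMap D.proj := by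
  intro U hU
  have h : D.proj ⁻¹' (D.proj '' U) = ⋃ n : ℤ, (D.T ^ n : leafAut hopfCover).1 '' U := by
    ext q
    simp only [mem_preimage, mem_image, mem_iUnion, proj_eq_iff]
    constructor
    · rintro ⟨p, hp, n, h⟩
      exact ⟨n, p, hp, h⟩
    · rintro ⟨n, p, hp, h⟩
      exact ⟨p, hp, n, h⟩
  refine (isQuotientMap_quot_mk (X := hopfCover)).isOpen_preimage.1 ?_
  change IsOpen (D.proj ⁻¹' (D.proj '' U))
  rw [h]
  exact isOpen_iUnion fun n => (D.T ^ n : leafAut hopfCover).1.isOpenMap _ hU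

theorem isLocalHomeomorph_proj : IsLocalHomeomorph D.proj := by
  rw [isLocalHomeomorph_iff_isOpenEmbedding_restrict]
  intro p
  obtain ⟨U, hU, hpU, H⟩ := D.exists_wandering p
  refine ⟨U, hU.mem_nhds hpU, ?_⟩
  refine IsOpenEmbedding.of_continuous_injective_isOpenMap
    (D.continuous_proj.comp continuous_subtype_val) ?_
    (D.isOpenMap_proj.comp hU.isOpenMap_subtype_val)
  rintro ⟨q, hq⟩ ⟨q', hq'⟩ h
  obtain ⟨n, hn⟩ := D.proj_eq_iff.1 h
  have h0 : n = 0 := H q hq n (by rw [hn]; exact hq')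
  subst h0
  exact Subtype.ext (by simpa using hn)

/-- The foliated charts of `R` are the local inverses of the projection `R̃ → R`, followed by
the inclusion of `R̃` in `ℂ × [0, ∞)`. -/
instance : ChartedSpace LeafModel D.Reeb where
  atlas := {c | ∀ q ∈ c.source, ∃ h : c q ∈ hopfCover, D.proj ⟨c q, h⟩ = q}
  chartAt q := D.isLocalHomeomorph_proj.localInverseAt q.out ≫ₕ
    hopfCover.openPartialHomeomorphSubtypeCoe inferInstance
  mem_chart_source q := by
    have h : D.proj q.out = q := Quotient.out_eq q
    have h2 := D.isLocalHomeomorph_proj.apply_self_mem_localInverseAt_source (x := q.out)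
    rw [h] at h2
    exact ⟨h2, mem_univ _⟩
  chart_mem_atlas q := by
    intro q' hq'
    exact ⟨(D.isLocalHomeomorph_proj.localInverseAt q.out q').2,
      D.isLocalHomeomorph_proj.apply_localInverseAt_of_mem hq'.1⟩

/-- `R` is a manifold with boundary with a foliation with complex leaves. -/
instance : HasGroupoid D.Reeb LeafModel.groupoid where
  compatible := by
    have key : ∀ c ∈ atlas LeafModel D.Reeb, ∀ c' ∈ atlas LeafModel D.Reeb,
        LeafModel.IsLeafwise (c.symm ≫ₕ c') (c.symm ≫ₕ c').source := by
      intro c hc c' hc'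
      refine LeafModel.pregroupoid.locality (OpenPartialHomeomorph.open_source _) fun p hp => ?_
      have lift : ∀ q ∈ (c.symm ≫ₕ c').source, ∃ (h : q ∈ hopfCover)
          (h' : (c.symm ≫ₕ c') q ∈ hopfCover), D.proj ⟨q, h⟩ = D.proj ⟨(c.symm ≫ₕ c') q, h'⟩ := by
        intro q hq
        obtain ⟨h, e⟩ := hc (c.symm q) (c.map_target hq.1)
        obtain ⟨h', e'⟩ := hc' (c.symm q) hq.2
        have hcq : c (c.symm q) = q := c.right_inv hq.1
        refine ⟨hcq ▸ h, h', ?_⟩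
        have : (⟨q, hcq ▸ h⟩ : hopfCover) = ⟨c (c.symm q), h⟩ := Subtype.ext hcq.symm
        rw [this, e]
        exact e'.symm
      obtain ⟨h, h', e⟩ := lift p hp
      obtain ⟨n, hn⟩ := D.proj_eq_iff.1 e
      obtain ⟨U, hU, hpU, H⟩ := D.exists_wandering ⟨p, h⟩
      let g := (D.lam, D.phi) ^ n
      have hTg := D.T_zpow n
      -- the translate of `U` by `T ^ n` and its image in the model
      let V : Set LeafModel := Subtype.val '' U
      let W : Set LeafModel := Subtype.val '' ((D.T ^ n : leafAut hopfCover).1 '' U)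
      have hV : IsOpen V := hopfCover.isOpen.isOpenMap_subtype_val _ hU
      have hW : IsOpen W := hopfCover.isOpen.isOpenMap_subtype_val _
        ((D.T ^ n : leafAut hopfCover).1.isOpenMap _ hU)
      have hO : IsOpen ((c.symm ≫ₕ c').source ∩ (c.symm ≫ₕ c') ⁻¹' W) :=
        (c.symm ≫ₕ c').continuousOn_toFun.isOpen_inter_preimage
          (OpenPartialHomeomorph.open_source _) hW
      refine ⟨V ∩ ((c.symm ≫ₕ c').source ∩ (c.symm ≫ₕ c') ⁻¹' W), hV.inter hO,
        ⟨⟨_, hpU, rfl⟩, hp, ⟨_, ⟨_, hpU, rfl⟩, by rw [hn]⟩⟩, ?_⟩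
      refine (isLeafwise_prod g _).congr
        ((OpenPartialHomeomorph.open_source _).inter (hV.inter hO)) ?_
      rintro q ⟨hq, ⟨r, hr, hrq⟩, -, ⟨_, ⟨s, hs, rfl⟩, hsq⟩⟩
      obtain ⟨k, k', e⟩ := lift q hq
      have hrq' : (⟨q, k⟩ : hopfCover) = r := Subtype.ext hrq.symm
      have hsq' : (⟨(c.symm ≫ₕ c') q, k'⟩ : hopfCover) = (D.T ^ n : leafAut hopfCover).1 s :=
        Subtype.ext hsq.symm
      rw [hrq', hsq'] at e
      have e2 : D.proj r = D.proj s := e.trans (D.proj_eq_iff.2 ⟨n, rfl⟩).symm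
      obtain ⟨m, hm⟩ := D.proj_eq_iff.1 e2
      have hm0 : m = 0 := H r hr m (by rw [hm]; exact hs)
      subst hm0
      have hrs : r = s := by simpa using hm
      rw [← hsq, ← hrs, hTg, hopfProd_apply, hrq]
    intro c c' hc hc'
    refine ⟨key c hc c' hc', ?_⟩
    have h := key c' hc' c hc
    have h2 : (c.symm ≫ₕ c').symm = c'.symm ≫ₕ c := by
      rw [OpenPartialHomeomorph.trans_symm_eq_symm_trans_symm, OpenPartialHomeomorph.symm_symm]
    rw [← h2] at h
    exact h

/-- The group `Aut(R̃; T)`: the centralizer of `T` in `Aut R̃`. -/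
abbrev AutT : Subgroup (leafAut hopfCover) := Subgroup.centralizer {D.T}

theorem T_mem : D.T ∈ D.AutT := Subgroup.mem_centralizer_singleton_iff.2 rfl

/-- The subgroup `T^ℤ` of `Aut(R̃; T)`. -/
abbrev zpowersT : Subgroup D.AutT := Subgroup.zpowers ⟨D.T, D.T_mem⟩

theorem normal_of_le_center {G : Type} [Group G] {H : Subgroup G} (h : H ≤ Subgroup.center G) :
    H.Normal where
  conj_mem n hn g := by
    rw [Subgroup.mem_center_iff.1 (h hn) g, mul_inv_cancel_right]
    exact hn

instance : D.zpowersT.Normal := by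
  refine normal_of_le_center ?_
  rw [Subgroup.zpowers_le, Subgroup.mem_center_iff]
  intro g
  exact Subtype.ext (Subgroup.mem_centralizer_singleton_iff.1 g.2)

/-- The centralizer `Z_φ` of `φ` in `Diff^∞([0, ∞))`. -/
abbrev Z : Subgroup DiffHalf := Subgroup.centralizer {D.phi}

theorem phi_mem : D.phi ∈ D.Z := Subgroup.mem_centralizer_singleton_iff.2 rfl

/-- The subgroup `(λ, φ)^ℤ` of `ℂ* × Z_φ`. -/
abbrev zpowersLamPhi : Subgroup (ℂˣ × D.Z) := Subgroup.zpowers (D.lam, ⟨D.phi, D.phi_mem⟩)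

instance : D.zpowersLamPhi.Normal := by
  refine normal_of_le_center ?_
  rw [Subgroup.zpowers_le, Subgroup.mem_center_iff]
  intro g
  exact Prod.ext (mul_comm _ _) (Subtype.ext (Subgroup.mem_centralizer_singleton_iff.1 g.2.2))

/-- The vector space `𝒦_{λ,φ}` of smooth functions `b : [0, ∞) → ℂ` with `b ∘ φ = λ b`. -/
def K : Submodule ℂ (ℝ≥0 → ℂ) where
  carrier := {b | SmoothHalf b ∧ ∀ x, b ((D.phi : ℝ≥0 ≃ₜ ℝ≥0) x) = D.lam * b x}
  zero_mem' := ⟨contDiffOn_const, by simp⟩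
  add_mem' := by
    intro b c hb hc
    refine ⟨ContDiffOn.add hb.1 hc.1, fun x => ?_⟩
    simp [hb.2 x, hc.2 x, mul_add]
  smul_mem' := by
    intro a b hb
    refine ⟨ContDiffOn.const_smul a hb.1, fun x => ?_⟩
    simp [hb.2 x, mul_left_comm]

end HopfData

end

/-!
The quotient map `R̃ → R` is the universal covering and `T^ℤ` is its deck group, so every
automorphism of `R` lifts to some `g` with `g T g⁻¹ = T` or `g T g⁻¹ = T⁻¹`; the second case is
impossible because `T` expands the leaf space `[0, ∞)`. This gives (i).

Let `g = (u, η)` commute with `T`. On the leaf through `x > 0` the function `u(·, x)` is entire, and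
pulling it back by powers of `T` to the compact fundamental domain `1 ≤ |z| ≤ |λ|` shows that it
grows at most linearly. Hence `u(z, x) = a(x) z + b(x)`. Here `a ∘ φ = a`, and `a` extends
continuously to `0`, so `a` is constant. Then `b = u(1, ·) - a` is smooth with `b ∘ φ = λ b`, and
`g = (z, x) ↦ (a z + b(x), η(x))`.

The action in (ii) is well defined because `Z_φ` is abelian: by Kopell's lemma an element of `Z_φ`
with a fixed point in `(0, ∞)` is the identity, so `Z_φ` acts freely on the ordered set `(0, ∞)`,
and Hölder's theorem applies.
-/

noncomputable section

/-! ### Hölder's theorem -/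

section OrderedGroup

variable {G : Type*} [Group G] [LinearOrder G] [MulLeftMono G] [MulRightMono G]

theorem exists_zpow_le_lt_zpow_add_one (arch : ∀ a b : G, 1 < a → ∃ n : ℕ, b ≤ a ^ n)
    {e : G} (he : 1 < e) (a : G) : ∃ m : ℤ, e ^ m ≤ a ∧ a < e ^ (m + 1) := by
  have he_mono : StrictMono fun m : ℤ => e ^ m := by
    refine strictMono_int_of_lt_succ fun m => ?_
    rw [zpow_add_one]
    exact lt_mul_of_one_lt_right' _ he
  obtain ⟨n, hn⟩ := arch e a he
  obtain ⟨n', hn'⟩ := arch e a⁻¹ he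
  have hlow : e ^ (-n' : ℤ) ≤ a := by
    rw [zpow_neg, zpow_natCast]
    exact inv_le_of_inv_le' hn'
  obtain ⟨m, hm, hm_max⟩ := Int.exists_greatest_of_bdd (P := fun m : ℤ => e ^ m ≤ a)
    ⟨n, fun m hm => he_mono.le_iff_le.1 (hm.trans (by simpa using hn))⟩ ⟨-n', hlow⟩
  exact ⟨m, hm, not_le.1 fun h => by have := hm_max _ h; omega⟩

theorem exists_eq_zpow_of_least (arch : ∀ a b : G, 1 < a → ∃ n : ℕ, b ≤ a ^ n)
    {e : G} (he : IsLeast {x | 1 < x} e) (a : G) : ∃ m : ℤ, a = e ^ m := by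
  obtain ⟨m, hm, hm'⟩ := exists_zpow_le_lt_zpow_add_one arch he.1 a
  refine ⟨m, by_contra fun hne => hm'.not_ge ?_⟩
  have hlt : 1 < (e ^ m)⁻¹ * a := by
    simpa [lt_inv_mul_iff_mul_lt] using hm.lt_of_ne (Ne.symm hne)
  rw [zpow_add_one]
  exact le_inv_mul_iff_mul_le.1 (he.2 hlt)

theorem exists_one_lt_mul_self_le (h : ¬∃ e : G, IsLeast {x | 1 < x} e) {c : G} (hc : 1 < c) :
    ∃ d, 1 < d ∧ d * d ≤ c := by
  obtain ⟨x, hx, hxc⟩ : ∃ x, 1 < x ∧ x < c := by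
    by_contra! hmin
    exact h ⟨c, hc, hmin⟩
  refine ⟨min x (x⁻¹ * c), lt_min hx (by simpa [lt_inv_mul_iff_mul_lt]), ?_⟩
  calc min x (x⁻¹ * c) * min x (x⁻¹ * c)
    _ ≤ x * (x⁻¹ * c) := mul_le_mul' (min_le_left _ _) (min_le_right _ _)
    _ = c := mul_inv_cancel_left x c

theorem mul_le_mul_swap_of_not_exists_least (arch : ∀ a b : G, 1 < a → ∃ n : ℕ, b ≤ a ^ n)
    (h : ¬∃ e : G, IsLeast {x | 1 < x} e) (a b : G) : a * b ≤ b * a := by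
  by_contra! hlt
  obtain ⟨d, hd, hdc⟩ := exists_one_lt_mul_self_le h (c := a * b * (b * a)⁻¹)
    (by simpa only [lt_mul_inv_iff_mul_lt, one_mul])
  obtain ⟨m, hm, hm'⟩ := exists_zpow_le_lt_zpow_add_one arch hd a
  obtain ⟨n, hn, hn'⟩ := exists_zpow_le_lt_zpow_add_one arch hd b
  refine (le_mul_inv_iff_mul_le.1 hdc).not_gt ?_
  calc a * b < d ^ (m + 1) * d ^ (n + 1) := mul_lt_mul_of_lt_of_lt hm' hn'
    _ = d * d * (d ^ n * d ^ m) := by group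
    _ ≤ d * d * (b * a) := by gcongr

theorem mul_comm_of_archimedean (arch : ∀ a b : G, 1 < a → ∃ n : ℕ, b ≤ a ^ n) (a b : G) :
    a * b = b * a := by
  by_cases h : ∃ e : G, IsLeast {x | 1 < x} e
  · obtain ⟨e, he⟩ := h
    obtain ⟨m, rfl⟩ := exists_eq_zpow_of_least arch he a
    obtain ⟨n, rfl⟩ := exists_eq_zpow_of_least arch he b
    exact zpow_mul_comm e m n
  · exact le_antisymm (mul_le_mul_swap_of_not_exists_least arch h a b)
      (mul_le_mul_swap_of_not_exists_least arch h b a)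

end OrderedGroup

theorem strictMono_homeomorph_nnreal (f : ℝ≥0 ≃ₜ ℝ≥0) : StrictMono f := by
  refine (f.continuous.strictMono_of_inj f.injective).resolve_right fun h => ?_
  have := h zero_lt_one
  simp [Homeomorph.nnreal_map_zero] at this

theorem homeomorph_nnreal_pos (f : ℝ≥0 ≃ₜ ℝ≥0) {x : ℝ≥0} (hx : 0 < x) : 0 < f x := by
  simpa only [Homeomorph.nnreal_map_zero] using strictMono_homeomorph_nnreal f hx

section FreeAction

variable {G : Type*} [Group G] {ρ : G →* (ℝ≥0 ≃ₜ ℝ≥0)}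
  (free : ∀ g : G, ∀ x : ℝ≥0, 0 < x → ρ g x = x → g = 1)
include free

theorem eq_of_apply_eq_of_free {g h : G} {x : ℝ≥0} (hx : 0 < x) (hgh : ρ g x = ρ h x) :
    g = h := by
  refine (inv_mul_eq_one.1 (free (g⁻¹ * h) x hx ?_))
  rw [map_mul, map_inv, Homeomorph.mul_apply, ← hgh]
  exact (ρ g).symm_apply_apply x

theorem apply_lt_apply_of_free {g h : G} {x y : ℝ≥0} (hx : 0 < x) (hy : 0 < y)
    (hgh : ρ g x < ρ h x) : ρ g y < ρ h y := by
  by_contra! hle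
  obtain ⟨z, hz, hzeq⟩ := isPreconnected_Ioi.intermediate_value₂ (s := Ioi (0 : ℝ≥0)) hx hy
    (ρ g).continuous.continuousOn (ρ h).continuous.continuousOn hgh.le hle
  rw [eq_of_apply_eq_of_free free hz hzeq] at hgh
  exact hgh.false

theorem exists_le_pow_apply_of_free {g : G} {x : ℝ≥0} (hx : 0 < x) (hg : x < ρ g x) (y : ℝ≥0) :
    ∃ n : ℕ, y ≤ ρ (g ^ n) x := by
  by_contra! hlt
  have hmono : Monotone fun n : ℕ => ρ (g ^ n) x := by
    refine monotone_nat_of_le_succ fun n => ?_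
    rw [pow_succ, map_mul, Homeomorph.mul_apply]
    exact (strictMono_homeomorph_nnreal _).monotone hg.le
  have hbdd : BddAbove (range fun n : ℕ => ρ (g ^ n) x) := ⟨y, by
    rintro _ ⟨n, rfl⟩
    exact (hlt n).le⟩
  have hlim := tendsto_atTop_ciSup hmono hbdd
  have hfix : ρ g (⨆ n : ℕ, ρ (g ^ n) x) = ⨆ n : ℕ, ρ (g ^ n) x := by
    refine tendsto_nhds_unique (((ρ g).continuous.tendsto _).comp hlim)
      (((Filter.tendsto_add_atTop_iff_nat 1).2 hlim).congr fun n => ?_)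
    rw [pow_succ', map_mul, Homeomorph.mul_apply, Function.comp_apply]
  have hpos : 0 < ⨆ n : ℕ, ρ (g ^ n) x := hx.trans_le (by simpa using le_ciSup hbdd 0)
  rw [free g _ hpos hfix] at hg
  simp at hg

theorem mul_comm_of_free (a b : G) : a * b = b * a := by
  let _ : LinearOrder G := LinearOrder.lift' (fun g => ρ g 1) fun g h =>
    eq_of_apply_eq_of_free free one_pos
  have hle {g h : G} : g ≤ h ↔ ρ g 1 ≤ ρ h 1 := Iff.rfl
  have hlt {g h : G} : g < h ↔ ρ g 1 < ρ h 1 := Iff.rfl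
  have : MulLeftMono G := ⟨fun g h k hhk => by
    simp only [hle, map_mul, Homeomorph.mul_apply] at hhk ⊢
    exact (strictMono_homeomorph_nnreal _).monotone hhk⟩
  have : MulRightStrictMono G := ⟨fun g h k hhk => by
    simp only [hlt, Function.swap, map_mul, Homeomorph.mul_apply] at hhk ⊢
    exact apply_lt_apply_of_free free one_pos (homeomorph_nnreal_pos _ one_pos) hhk⟩
  have : MulRightMono G := mulRightMono_of_mulRightStrictMono G
  exact mul_comm_of_archimedean (fun g h hg =>
    exists_le_pow_apply_of_free free one_pos (by simpa [hlt] using hg) (ρ h 1)) a b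

end FreeAction

/-! ### Kopell's lemma -/

section Coercions

variable {X : Type*} [TopologicalSpace X] {H : Subgroup (X ≃ₜ X)}

instance : CoeFun H fun _ => X → X := ⟨fun f => f.1⟩

instance {H' : Subgroup H} : CoeFun H' fun _ => X → X := ⟨fun f => f.1.1⟩

end Coercions

namespace DiffHalf

theorem mul_apply (f g : DiffHalf) (x : ℝ≥0) : (f * g) x = f (g x) := rfl

theorem inv_apply_self (f : DiffHalf) (x : ℝ≥0) : f⁻¹ (f x) = x := f.1.symm_apply_apply x

theorem apply_inv_self (f : DiffHalf) (x : ℝ≥0) : f (f⁻¹ x) = x := f.1.apply_symm_apply x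

theorem inv_apply_eq_self {f : DiffHalf} {x : ℝ≥0} (hx : f x = x) : f⁻¹ x = x := by
  conv_lhs => rw [← hx, inv_apply_self]

theorem pow_succ_apply (f : DiffHalf) (n : ℕ) (x : ℝ≥0) : (f ^ (n + 1)) x = f ((f ^ n) x) := by
  rw [pow_succ', mul_apply]

theorem pow_apply (f : DiffHalf) (n : ℕ) (x : ℝ≥0) : (f ^ n) x = f^[n] x := by
  induction n with
  | zero => rfl
  | succ n ih => rw [pow_succ_apply, ih, Function.iterate_succ_apply']

theorem apply_zero (f : DiffHalf) : f 0 = 0 := Homeomorph.nnreal_map_zero f.1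

theorem strictMono (f : DiffHalf) : StrictMono f := strictMono_homeomorph_nnreal f.1

theorem apply_pos (f : DiffHalf) {x : ℝ≥0} (hx : 0 < x) : 0 < f x := homeomorph_nnreal_pos f.1 hx

theorem continuous (f : DiffHalf) : Continuous f := f.1.continuous

theorem apply_comm {f h : DiffHalf} (hfh : Commute f h) (x : ℝ≥0) : f (h x) = h (f x) := by
  rw [← mul_apply, hfh.eq, mul_apply]

/-- The derivative of a diffeomorphism of `[0, ∞)`, one-sided at `0`. -/
def der (f : DiffHalf) (x : ℝ≥0) : ℝ := derivWithin (fun t : ℝ => (f t.toNNReal : ℝ)) (Ici 0) x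

theorem hasDerivWithinAt (f : DiffHalf) (x : ℝ≥0) :
    HasDerivWithinAt (fun t : ℝ => (f t.toNNReal : ℝ)) (der f x) (Ici 0) x :=
  (f.2.1.differentiableOn (by simp) x x.2).hasDerivWithinAt

theorem der_eq {f : DiffHalf} {x : ℝ≥0} {d : ℝ}
    (h : HasDerivWithinAt (fun t : ℝ => (f t.toNNReal : ℝ)) d (Ici 0) x) : der f x = d :=
  h.derivWithin (uniqueDiffOn_Ici 0 _ x.2)

theorem der_one (x : ℝ≥0) : der 1 x = 1 :=
  der_eq ((hasDerivWithinAt_id _ _).congr_of_mem (fun _ ht => Real.coe_toNNReal _ ht) x.2)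

theorem der_mul (f g : DiffHalf) (x : ℝ≥0) : der (f * g) x = der f (g x) * der g x := by
  have hf : HasDerivWithinAt (fun t : ℝ => (f t.toNNReal : ℝ)) (der f (g x)) (Ici 0)
      (g (x : ℝ).toNNReal : ℝ) := by
    rw [Real.toNNReal_coe]
    exact hasDerivWithinAt f (g x)
  refine der_eq ((hf.comp (x : ℝ) (hasDerivWithinAt g x) fun t _ => (g t.toNNReal).2).congr_of_mem
    (fun t _ => ?_) x.2)
  rw [Function.comp_apply, Real.toNNReal_coe, mul_apply]

theorem der_pos (f : DiffHalf) (x : ℝ≥0) : 0 < der f x := by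
  have hnonneg : 0 ≤ der f x := MonotoneOn.derivWithin_nonneg fun s _ t _ hst => by
    exact_mod_cast (strictMono f).monotone (Real.toNNReal_mono hst)
  refine hnonneg.lt_of_ne' fun h => one_ne_zero (α := ℝ) ?_
  rw [← der_one x, ← inv_mul_cancel f, der_mul, h, mul_zero]

theorem contDiffOn_der (f : DiffHalf) : ContDiffOn ℝ 1 (fun t : ℝ => der f t.toNNReal) (Ici 0) :=
  (ContDiffOn.derivWithin f.2.1 (uniqueDiffOn_Ici 0) (by norm_cast)).congr fun t ht => by
    rw [der, Real.coe_toNNReal t ht]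

theorem continuous_der (f : DiffHalf) : Continuous (der f) := by
  refine ((contDiffOn_der f).continuousOn.comp_continuous NNReal.continuous_coe
    fun x => x.2).congr fun x => ?_
  rw [Function.comp_apply, Real.toNNReal_coe]

theorem exists_der_le_exp_mul (f : DiffHalf) (p : ℝ≥0) : ∃ C : ℝ, 0 ≤ C ∧
    ∀ x ≤ p, ∀ y ≤ p, der f x ≤ Real.exp (C * |(x : ℝ) - y|) * der f y := by
  have hlog : ContDiffOn ℝ 1 (fun t : ℝ => Real.log (der f t.toNNReal)) (Ici 0) :=
    (contDiffOn_der f).log fun t _ => (der_pos f _).ne'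
  obtain ⟨C, hC⟩ := (isCompact_Icc (a := (0 : ℝ)) (b := p)).exists_bound_of_continuousOn
    ((hlog.continuousOn_derivWithin (uniqueDiffOn_Ici 0) le_rfl).mono fun t ht => ht.1)
  refine ⟨C, (norm_nonneg _).trans (hC 0 ⟨le_rfl, p.2⟩), fun x hx y hy => ?_⟩
  have hlip := Convex.norm_image_sub_le_of_norm_hasDerivWithin_le
    (fun t (ht : t ∈ Icc (0 : ℝ) p) =>
      ((hlog.differentiableOn one_ne_zero t ht.1).hasDerivWithinAt).mono fun s hs => hs.1)
    hC (convex_Icc _ _) (x := (y : ℝ)) (y := (x : ℝ)) ⟨y.2, hy⟩ ⟨x.2, hx⟩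
  simp only [Real.norm_eq_abs, Real.toNNReal_coe] at hlip
  rw [← Real.log_le_log_iff (der_pos f x) (by positivity [der_pos f y]), Real.log_mul
    (Real.exp_ne_zero _) (der_pos f y).ne', Real.log_exp]
  linarith [le_abs_self (Real.log (der f x) - Real.log (der f y))]

theorem dist_apply_le_of_der_le {f : DiffHalf} {a b : ℝ≥0} {C : ℝ}
    (hC : ∀ x ∈ Icc a b, der f x ≤ C) {x y : ℝ≥0} (hx : x ∈ Icc a b) (hy : y ∈ Icc a b) :
    dist (f x) (f y) ≤ C * dist x y := by
  have h := Convex.norm_image_sub_le_of_norm_hasDerivWithin_le (s := Icc (a : ℝ) b)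
    (f := fun t : ℝ => (f t.toNNReal : ℝ)) (f' := fun t => der f t.toNNReal) (C := C)
    (fun t ht => ?_) (fun t ht => ?_) (convex_Icc _ _) (x := (y : ℝ)) (y := (x : ℝ)) hy hx
  · simpa only [Real.toNNReal_coe, Real.norm_eq_abs, ← NNReal.dist_eq] using h
  · lift t to ℝ≥0 using a.2.trans ht.1
    rw [Real.toNNReal_coe]
    exact (hasDerivWithinAt f t).mono fun s hs => a.2.trans hs.1
  · lift t to ℝ≥0 using a.2.trans ht.1
    rw [Real.toNNReal_coe, Real.norm_of_nonneg (der_pos f t).le]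
    exact hC t ht

theorem der_zero_eq_one_of_tendsto_fixed {f : DiffHalf} {u : ℕ → ℝ≥0} (hu0 : ∀ n, u n ≠ 0)
    (hu : Filter.Tendsto u Filter.atTop (𝓝 0)) (hfix : ∀ n, f (u n) = u n) : der f 0 = 1 := by
  have hslope := hasDerivWithinAt_iff_tendsto_slope.1 (hasDerivWithinAt f 0)
  have hu' : Filter.Tendsto (fun n => (u n : ℝ)) Filter.atTop (𝓝[Ici 0 \ {0}] ((0 : ℝ≥0) : ℝ)) :=
    tendsto_nhdsWithin_iff.2 ⟨NNReal.tendsto_coe.2 hu,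
      Filter.Eventually.of_forall fun n => ⟨(u n).2, by simpa using hu0 n⟩⟩
  refine tendsto_nhds_unique (hslope.comp hu') (tendsto_const_nhds.congr fun n => ?_)
  have hn : (u n : ℝ) ≠ 0 := by exact_mod_cast hu0 n
  simp [slope_def_field, hfix, apply_zero, hn]

end DiffHalf

theorem mapsTo_Icc_of_apply_eq {α : Type*} [Preorder α] {g : α → α} (hg : Monotone g) {a b : α}
    (ha : g a = a) (hb : g b = b) : MapsTo g (Icc a b) (Icc a b) := fun _ hx =>
  ⟨ha.symm.le.trans (hg hx.1), (hg hx.2).trans hb.le⟩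

theorem exists_tendsto_iterate_isFixedPt {α : Type*} [ConditionallyCompleteLinearOrder α]
    [TopologicalSpace α] [OrderTopology α] {g : α → α} (hg : Monotone g) (hgc : Continuous g)
    {a b x : α} (ha : g a = a) (hb : g b = b) (hx : x ∈ Icc a b) :
    ∃ u ∈ Icc a b, g u = u ∧ Filter.Tendsto (fun n => g^[n] x) Filter.atTop (𝓝 u) := by
  have hmem (n : ℕ) : g^[n] x ∈ Icc a b :=
    (mapsTo_Icc_of_apply_eq hg ha hb).iterate n hx
  obtain ⟨u, hu⟩ : ∃ u, Filter.Tendsto (fun n => g^[n] x) Filter.atTop (𝓝 u) := by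
    rcases le_total x (g x) with h | h
    · exact ⟨_, tendsto_atTop_ciSup (hg.monotone_iterate_of_le_map h)
        ⟨b, forall_mem_range.2 fun n => (hmem n).2⟩⟩
    · exact ⟨_, tendsto_atTop_ciInf (hg.antitone_iterate_of_map_le h)
        ⟨a, forall_mem_range.2 fun n => (hmem n).1⟩⟩
  exact ⟨u, isClosed_Icc.mem_of_tendsto hu (Filter.Eventually.of_forall hmem),
    isFixedPt_of_tendsto_iterate hu hgc.continuousAt, hu⟩

namespace DiffHalf

section Contraction

variable {f : DiffHalf} (hf : ∀ x : ℝ≥0, 0 < x → f x < x)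
include hf

theorem apply_le_of_contracting (x : ℝ≥0) : f x ≤ x := by
  rcases eq_or_ne x 0 with rfl | hx
  · exact (apply_zero f).le
  · exact (hf x (pos_iff_ne_zero.2 hx)).le

theorem pow_apply_antitone_of_contracting (x : ℝ≥0) : Antitone fun n : ℕ => (f ^ n) x :=
  antitone_nat_of_succ_le fun n => by
    rw [pow_succ_apply]
    exact apply_le_of_contracting hf _

theorem tendsto_pow_apply_of_contracting (x : ℝ≥0) :
    Filter.Tendsto (fun n : ℕ => (f ^ n) x) Filter.atTop (𝓝 0) := by
  have h := tendsto_atTop_ciInf (pow_apply_antitone_of_contracting hf x) (OrderBot.bddBelow _)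
  have hfix : f (⨅ n : ℕ, (f ^ n) x) = ⨅ n : ℕ, (f ^ n) x :=
    isFixedPt_of_tendsto_iterate (by simpa only [pow_apply] using h) (continuous f).continuousAt
  rcases eq_or_ne (⨅ n : ℕ, (f ^ n) x) 0 with h0 | h0
  · rwa [h0] at h
  · exact absurd hfix (hf _ (pos_iff_ne_zero.2 h0)).ne

theorem exists_pow_apply_le_of_contracting {p : ℝ≥0} (hp : 0 < p) (x : ℝ≥0) :
    ∃ n : ℕ, (f ^ n) x ≤ p :=
  ((tendsto_pow_apply_of_contracting hf x).eventually_le_const hp).exists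

theorem exists_mem_Icc_pow_apply_of_contracting {p x : ℝ≥0} (hx : 0 < x) (hxp : x ≤ p) :
    ∃ n : ℕ, x ∈ Icc (f ((f ^ n) p)) ((f ^ n) p) := by
  classical
  have hex := exists_pow_apply_le_of_contracting hf hx p
  rcases hn : Nat.find hex with _ | n
  · have hpx : p ≤ x := (Nat.find_eq_zero hex).1 hn
    exact ⟨0, (apply_le_of_contracting hf _).trans hpx, hxp⟩
  · refine ⟨n, ?_, (not_le.1 (Nat.find_min hex (m := n) (by omega))).le⟩
    rw [← pow_succ_apply, ← hn]
    exact Nat.find_spec hex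

/-- The key estimate: the constant does not depend on the number of iterations, because the
intervals `[fⁿ⁺¹ p, fⁿ p]` have disjoint interiors. -/
theorem exists_der_pow_le_mul (p : ℝ≥0) : ∃ C : ℝ, ∀ n : ℕ, ∀ x ∈ Icc (f p) p, ∀ y ∈ Icc (f p) p,
    der (f ^ n) x ≤ C * der (f ^ n) y := by
  obtain ⟨C, hC, hder⟩ := exists_der_le_exp_mul f p
  refine ⟨Real.exp (C * p), fun n x hx y hy => ?_⟩
  suffices der (f ^ n) x ≤ Real.exp (C * (p - (f ^ n) p)) * der (f ^ n) y from
    this.trans (by gcongr; exacts [(der_pos _ y).le, sub_le_self _ NNReal.zero_le_coe])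
  induction n with
  | zero => simp [der_one]
  | succ n ih =>
    have hmem {z : ℝ≥0} (hz : z ∈ Icc (f p) p) :
        (f ^ n) z ∈ Icc ((f ^ (n + 1)) p) ((f ^ n) p) := by
      rw [pow_succ, mul_apply]
      exact ⟨(strictMono _).monotone hz.1, (strictMono _).monotone hz.2⟩
    have hle : (f ^ n) p ≤ p := pow_apply_antitone_of_contracting hf p (Nat.zero_le n)
    have hdist : |((f ^ n) x : ℝ) - (f ^ n) y| ≤ (f ^ n) p - (f ^ (n + 1)) p :=
      abs_sub_le_of_le_of_le (hmem hx).1 (hmem hx).2 (hmem hy).1 (hmem hy).2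
    rw [pow_succ', der_mul, der_mul]
    calc der f ((f ^ n) x) * der (f ^ n) x
      _ ≤ Real.exp (C * ((f ^ n) p - (f ^ (n + 1)) p)) * der f ((f ^ n) y) *
          (Real.exp (C * (p - (f ^ n) p)) * der (f ^ n) y) := by
        refine mul_le_mul ((hder _ ((hmem hx).2.trans hle) _ ((hmem hy).2.trans hle)).trans ?_) ih
          (der_pos _ _).le (mul_nonneg (Real.exp_nonneg _) (der_pos _ _).le)
        gcongr
        exact (der_pos _ _).le
      _ = Real.exp (C * (p - (f * f ^ n) p)) * (der f ((f ^ n) y) * der (f ^ n) y) := by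
        rw [mul_mul_mul_comm, ← Real.exp_add, ← pow_succ']
        ring_nf

theorem der_le_of_der_pow_le_mul {p : ℝ≥0} (hp : 0 < p) {C : ℝ}
    (hC : ∀ n : ℕ, ∀ x ∈ Icc (f p) p, ∀ y ∈ Icc (f p) p, der (f ^ n) x ≤ C * der (f ^ n) y)
    {h : DiffHalf} (hcomm : Commute f h) (hfix : h p = p) {x : ℝ≥0} (hx : x ∈ Icc (f p) p) :
    der h x ≤ C := by
  have hfixn (n : ℕ) : h ((f ^ n) p) = (f ^ n) p := by
    rw [← apply_comm (hcomm.pow_left n), hfix]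
  have hhx : h x ∈ Icc (f p) p :=
    mapsTo_Icc_of_apply_eq (strictMono h).monotone (by rw [← apply_comm hcomm, hfix]) hfix hx
  have hbound (n : ℕ) : der h x ≤ C * der h ((f ^ n) x) := by
    have hchain : der (f ^ n) (h x) * der h x = der h ((f ^ n) x) * der (f ^ n) x := by
      rw [← der_mul, ← der_mul, (hcomm.pow_left n).eq]
    refine le_of_mul_le_mul_left ?_ (der_pos (f ^ n) (h x))
    calc der (f ^ n) (h x) * der h x = der h ((f ^ n) x) * der (f ^ n) x := hchain
      _ ≤ der h ((f ^ n) x) * (C * der (f ^ n) (h x)) := by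
        gcongr
        · exact (der_pos _ _).le
        · exact hC n x hx _ hhx
      _ = der (f ^ n) (h x) * (C * der h ((f ^ n) x)) := by ring
  have hder_zero : der h 0 = 1 := der_zero_eq_one_of_tendsto_fixed
    (fun n => (apply_pos (f ^ n) hp).ne') (tendsto_pow_apply_of_contracting hf p) hfixn
  have hlim : Filter.Tendsto (fun n : ℕ => C * der h ((f ^ n) x)) Filter.atTop (𝓝 C) := by
    simpa [hder_zero] using
      (((continuous_der h).tendsto 0).comp (tendsto_pow_apply_of_contracting hf x)).const_mul C
  exact ge_of_tendsto' hlim hbound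

theorem apply_eq_self_of_mem_Icc {h : DiffHalf} (hcomm : Commute f h) {p : ℝ≥0} (hp : 0 < p)
    (hfix : h p = p) {x : ℝ≥0} (hx : x ∈ Icc (f p) p) : h x = x := by
  obtain ⟨C, hC⟩ := exists_der_pow_le_mul hf p
  have hfix' : h⁻¹ p = p := inv_apply_eq_self hfix
  have hfixf : h⁻¹ (f p) = f p := by rw [← apply_comm hcomm.inv_right, hfix']
  obtain ⟨u, hu, hufix, hlim⟩ := exists_tendsto_iterate_isFixedPt (strictMono h⁻¹).monotone
    (continuous h⁻¹) hfixf hfix' hx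
  have hufix' : h u = u := by simpa only [inv_inv] using inv_apply_eq_self hufix
  have hfixpow {y : ℝ≥0} (hy : h y = y) (n : ℕ) : (h ^ n) y = y := by
    rw [pow_apply, Function.iterate_fixed hy]
  -- `hⁿ` fixes `u` and is `C`-Lipschitz, uniformly in `n`.
  have hdist (n : ℕ) : dist x u ≤ C * dist ((h⁻¹ ^ n) x) u := by
    have hmem : (h⁻¹ ^ n) x ∈ Icc (f p) p := by
      rw [pow_apply]
      exact (mapsTo_Icc_of_apply_eq (strictMono h⁻¹).monotone hfixf hfix').iterate n hx
    have h := dist_apply_le_of_der_le (f := h ^ n)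
      (fun y hy => der_le_of_der_pow_le_mul hf hp hC (hcomm.pow_right n) (hfixpow hfix n) hy)
      hmem hu
    rwa [inv_pow, apply_inv_self, hfixpow hufix', ← inv_pow] at h
  have hlim' : Filter.Tendsto (fun n : ℕ => C * dist ((h⁻¹ ^ n) x) u) Filter.atTop (𝓝 0) := by
    simp only [pow_apply]
    simpa only [dist_self, mul_zero] using (hlim.dist (tendsto_const_nhds (x := u))).const_mul C
  have hxu : x = u := dist_le_zero.1 (ge_of_tendsto' hlim' hdist)
  rw [hxu, hufix']

/-- Kopell's lemma. -/
theorem eq_one_of_commute_of_apply_eq {h : DiffHalf} (hcomm : Commute f h) {p : ℝ≥0} (hp : 0 < p)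
    (hfix : h p = p) : h = 1 := by
  have hfix_le {x : ℝ≥0} (hx : 0 < x) (hxp : x ≤ p) : h x = x := by
    obtain ⟨n, hn⟩ := exists_mem_Icc_pow_apply_of_contracting hf hx hxp
    refine apply_eq_self_of_mem_Icc hf hcomm (apply_pos (f ^ n) hp) ?_ hn
    rw [← apply_comm (hcomm.pow_left n), hfix]
  refine Subtype.ext (Homeomorph.ext fun x => ?_)
  change h x = x
  rcases eq_or_ne x 0 with rfl | hx
  · exact apply_zero h
  obtain ⟨n, hn⟩ := exists_pow_apply_le_of_contracting hf hp x
  refine (f ^ n).1.injective ?_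
  rw [apply_comm (hcomm.pow_left n), hfix_le (apply_pos _ (pos_iff_ne_zero.2 hx)) hn]

theorem centralizer_mul_comm (g h : Subgroup.centralizer {f}) : g * h = h * g := by
  refine mul_comm_of_free (ρ := DiffHalf.subtype.comp (Subgroup.subtype _))
    (fun k x hx hkx => Subtype.ext ?_) g h
  exact eq_one_of_commute_of_apply_eq hf (Subgroup.mem_centralizer_singleton_iff.1 k.2).symm hx hkx

end Contraction

end DiffHalf

/-! ### Lifting homeomorphisms of `R` to `R̃` -/

section Covering

variable {E X : Type*} [TopologicalSpace E] [TopologicalSpace X] {p : E → X}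

instance : MulAction (E ≃ₜ E) E where
  smul h e := h e
  one_smul _ := rfl
  mul_smul _ _ _ := rfl

theorem exists_homeomorph_lift [SimplyConnectedSpace E] [LocallyPathConnectedSpace E]
    (hp : IsCoveringMap p) (hsurj : Function.Surjective p) (f : X ≃ₜ X) :
    ∃ g : E ≃ₜ E, ∀ e, p (g e) = f (p e) := by
  let e₀ : E := Classical.arbitrary E
  obtain ⟨e₁, he₁⟩ := hsurj (f (p e₀))
  obtain ⟨F, ⟨hF₀, hF⟩, -⟩ := hp.existsUnique_continuousMap_lifts
    ⟨fun e => f (p e), f.continuous.comp hp.continuous⟩ e₀ e₁ he₁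
  obtain ⟨G, ⟨hG₀, hG⟩, -⟩ := hp.existsUnique_continuousMap_lifts
    ⟨fun e => f.symm (p e), f.symm.continuous.comp hp.continuous⟩ e₁ e₀ (by simp [he₁])
  have hpF : ∀ e, p (F e) = f (p e) := congrFun hF
  have hpG : ∀ e, p (G e) = f.symm (p e) := congrFun hG
  have hGF : G ∘ F = id := hp.eq_of_comp_eq (G.continuous.comp F.continuous) continuous_id
    (funext fun e => by simp [hpF, hpG]) e₀ (by simp [hF₀, hG₀])
  have hFG : F ∘ G = id := hp.eq_of_comp_eq (F.continuous.comp G.continuous) continuous_id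
    (funext fun e => by simp [hpF, hpG]) e₁ (by simp [hF₀, hG₀])
  exact ⟨⟨⟨F, G, congrFun hGF, congrFun hFG⟩, F.continuous, G.continuous⟩, hpF⟩

theorem mem_iff_of_isQuotientCoveringMap [ConnectedSpace E] {Γ : Subgroup (E ≃ₜ E)}
    (hp : IsQuotientCoveringMap p Γ) {h : E ≃ₜ E} : h ∈ Γ ↔ ∀ e, p (h e) = p e := by
  refine ⟨fun hh e => hp.map_smul (⟨h, hh⟩ : Γ), fun hh => ?_⟩
  let e₀ : E := Classical.arbitrary E
  obtain ⟨γ, hγ⟩ := hp.apply_eq_iff_mem_orbit.1 (hh e₀)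
  have hγh : ⇑(γ : E ≃ₜ E) = h := hp.isCoveringMap.eq_of_comp_eq γ.1.continuous h.continuous
    (funext fun e => (hp.map_smul γ).trans (hh e).symm) e₀ hγ
  rw [← DFunLike.coe_injective hγh]
  exact γ.2

theorem conj_eq_or_eq_inv_of_conj_mem_zpowers {G : Type*} [Group G] {t g : G}
    (ht : Function.Injective fun n : ℤ => t ^ n) (h : g * t * g⁻¹ ∈ Subgroup.zpowers t)
    (h' : g⁻¹ * t * g ∈ Subgroup.zpowers t) : g * t * g⁻¹ = t ∨ g * t * g⁻¹ = t⁻¹ := by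
  obtain ⟨k, hk : t ^ k = g * t * g⁻¹⟩ := h
  obtain ⟨l, hl : t ^ l = g⁻¹ * t * g⟩ := h'
  have hkl : k * l = 1 := ht <| by
    simp only [zpow_mul, hk, conj_zpow, hl]
    group
  obtain rfl | rfl := Int.eq_one_or_neg_one_of_mul_eq_one hkl
  · exact .inl (by rw [← hk, zpow_one])
  · exact .inr (by rw [← hk, zpow_neg_one])

end Covering

instance : LocallyPathConnectedSpace LeafModel :=
  (IsQuotientMap.of_inverse LeafModel.continuous_incl LeafModel.continuous_retr
    LeafModel.retr_incl).locallyPathConnectedSpace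

instance : LocallyPathConnectedSpace hopfCover :=
  hopfCover.isOpen.locallyPathConnectedSpace

theorem convexCombination_mem_hopfCover (t : unitInterval) (p : hopfCover) :
    (((unitInterval.symm t : ℝ) : ℂ) * p.1.1,
      unitInterval.toNNReal (unitInterval.symm t) * p.1.2 + unitInterval.toNNReal t) ∈
        hopfCover := by
  intro h
  obtain ⟨h₁, h₂, h₃⟩ : _ = (0 : ℂ) ∧ _ = (0 : ℝ≥0) ∧ unitInterval.toNNReal t = 0 := by
    simpa only [mem_singleton_iff, Prod.ext_iff, Prod.fst_zero, Prod.snd_zero, add_eq_zero] using h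
  obtain rfl : t = 0 := Subtype.ext (congrArg ((↑) : ℝ≥0 → ℝ) h₃)
  exact p.2 (Prod.ext (by simpa using h₁) (by simpa using h₂))

/-- `R̃` is star-shaped about `(0, 1)`. -/
instance : ContractibleSpace hopfCover := by
  rw [contractible_iff_id_nullhomotopic]
  refine ⟨⟨(0, 1), by simp [hopfCover]⟩,
    ⟨⟨⟨fun q => ⟨_, convexCombination_mem_hopfCover q.1 q.2⟩, ?_⟩, ?_, ?_⟩⟩⟩
  · fun_prop
  · intro p
    ext <;> simp
  · intro p
    ext <;> simp

namespace HopfData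

variable (D : HopfData)

theorem proj_surjective : Function.Surjective D.proj := Quotient.mk_surjective

theorem eq_zero_of_T_zpow_eq_one {n : ℤ} (h : D.T.1 ^ n = 1) : n = 0 := by
  obtain ⟨U, -, hU, hn⟩ := D.exists_wandering (Classical.arbitrary hopfCover)
  refine hn _ hU n ?_
  rw [SubgroupClass.coe_zpow, h]
  exact hU

theorem T_zpow_injective : Function.Injective fun n : ℤ => D.T.1 ^ n := fun m n h =>
  sub_eq_zero.1 <| D.eq_zero_of_T_zpow_eq_one <| by rw [zpow_sub]; exact mul_inv_eq_one.2 h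

theorem isQuotientCoveringMap_proj :
    IsQuotientCoveringMap D.proj (Subgroup.zpowers D.T.1) where
  toIsQuotientMap := isQuotientMap_quot_mk
  continuous_const_smul γ := γ.1.continuous
  apply_eq_iff_mem_orbit {p q} := by
    rw [eq_comm, D.proj_eq_iff]
    constructor
    · rintro ⟨n, hn⟩
      exact ⟨⟨_, n, rfl⟩, hn⟩
    · rintro ⟨⟨_, n, rfl⟩, hn⟩
      exact ⟨n, hn⟩
  disjoint p := by
    obtain ⟨U, hU, hp, hn⟩ := D.exists_wandering p
    refine ⟨U, hU.mem_nhds hp, ?_⟩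
    rintro ⟨_, n, rfl⟩ ⟨_, ⟨q, hq, rfl⟩, hq'⟩
    obtain rfl := hn q hq n hq'
    rfl

theorem mem_zpowers_T_iff {h : hopfCover ≃ₜ hopfCover} :
    h ∈ Subgroup.zpowers D.T.1 ↔ ∀ p, D.proj (h p) = D.proj p :=
  mem_iff_of_isQuotientCoveringMap D.isQuotientCoveringMap_proj

theorem exists_lift (f : D.Reeb ≃ₜ D.Reeb) :
    ∃ g : hopfCover ≃ₜ hopfCover, ∀ p, D.proj (g p) = f (D.proj p) :=
  exists_homeomorph_lift D.isQuotientCoveringMap_proj.isCoveringMap D.proj_surjective f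

theorem conj_T_of_lift {f : D.Reeb ≃ₜ D.Reeb} {g : hopfCover ≃ₜ hopfCover}
    (h : ∀ p, D.proj (g p) = f (D.proj p)) :
    g * D.T.1 * g⁻¹ = D.T.1 ∨ g * D.T.1 * g⁻¹ = D.T.1⁻¹ := by
  have hT : ∀ p, D.proj (D.T.1 p) = D.proj p :=
    D.mem_zpowers_T_iff.1 (Subgroup.mem_zpowers _)
  have h' : ∀ p, D.proj (g⁻¹ p) = f.symm (D.proj p) := fun p => by
    rw [Homeomorph.eq_symm_apply, ← h]
    exact congrArg D.proj (g.apply_symm_apply p)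
  refine conj_eq_or_eq_inv_of_conj_mem_zpowers D.T_zpow_injective
    (D.mem_zpowers_T_iff.2 fun p => ?_) (D.mem_zpowers_T_iff.2 fun p => ?_)
  · simp only [Homeomorph.mul_apply, h, hT, h', Homeomorph.apply_symm_apply]
  · simp only [Homeomorph.mul_apply, h, hT, h', Homeomorph.symm_apply_apply]

end HopfData

/-! ### Leafwise maps in charts -/

namespace LeafModel

/-- The map `F` is leafwise holomorphic and foliated near `p`. -/
def LeafwiseAt (F : LeafModel → LeafModel) (p : LeafModel) : Prop :=
  ∃ u, IsOpen u ∧ p ∈ u ∧ IsLeafwise F u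

variable {F G : LeafModel → LeafModel} {p : LeafModel} {s : Set LeafModel}

theorem IsLeafwise.continuousOn (h : IsLeafwise F s) : ContinuousOn F s := by
  have hF : retr ∘ (incl ∘ F ∘ retr) ∘ incl = F := by
    funext q
    simp only [Function.comp_apply, retr_incl]
  rw [← hF]
  exact continuous_retr.comp_continuousOn
    (h.smooth.continuousOn.comp continuous_incl.continuousOn (mapsTo_image _ _))

theorem LeafwiseAt.congr (h : LeafwiseAt F p) (hGF : G =ᶠ[𝓝 p] F) : LeafwiseAt G p := by
  obtain ⟨u, hu, hp, h⟩ := h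
  obtain ⟨v, hv, hvo, hpv⟩ := mem_nhds_iff.1 hGF
  exact ⟨u ∩ v, hu.inter hvo, ⟨hp, hpv⟩,
    (h.mono inter_subset_left).congr (hu.inter hvo) fun q hq => hv hq.2⟩

theorem LeafwiseAt.comp (hG : LeafwiseAt G (F p)) (hF : LeafwiseAt F p) :
    LeafwiseAt (G ∘ F) p := by
  obtain ⟨u, hu, hp, hF⟩ := hF
  obtain ⟨v, hv, hpv, hG⟩ := hG
  have huv : IsOpen (u ∩ F ⁻¹' v) := hF.continuousOn.isOpen_inter_preimage hu hv
  exact ⟨u ∩ F ⁻¹' v, huv, ⟨hp, hpv⟩, pregroupoid.comp hF hG hu hv huv⟩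

theorem isLeafwise_iff_forall_leafwiseAt (hs : IsOpen s) :
    IsLeafwise F s ↔ ∀ p ∈ s, LeafwiseAt F p := by
  refine ⟨fun h p hp => ⟨s, hs, hp, h⟩, fun h => pregroupoid.locality hs fun p hp => ?_⟩
  obtain ⟨u, hu, hpu, h⟩ := h p hp
  exact ⟨u, hu, hpu, h.mono inter_subset_right⟩

theorem leafwiseAt_id : LeafwiseAt id p :=
  ⟨univ, isOpen_univ, mem_univ p, pregroupoid.id_mem⟩

theorem leafwiseAt_prod (g : ℂˣ × DiffHalf) :
    LeafwiseAt (fun q => ((g.1 : ℂ) * q.1, g.2 q.2)) p :=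
  ⟨univ, isOpen_univ, mem_univ p, isLeafwise_prod g _⟩

end LeafModel

open LeafModel

section Charts

variable {M : Type} [TopologicalSpace M] [ChartedSpace LeafModel M]

/-- The map `f` is leafwise holomorphic and foliated in all charts: one half of the condition that
defines `leafAut`. -/
def IsLeafwiseMap (f : M → M) : Prop :=
  ∀ c ∈ atlas LeafModel M, ∀ c' ∈ atlas LeafModel M, ∀ q ∈ c.target,
    f (c.symm q) ∈ c'.source → LeafwiseAt (c' ∘ f ∘ c.symm) q

theorem mem_leafAut_iff [HasGroupoid M LeafModel.groupoid] {f : M ≃ₜ M} :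
    f ∈ leafAut M ↔ IsLeafwiseMap f ∧ IsLeafwiseMap f.symm := by
  have hsource : ∀ (f : M ≃ₜ M) (c c' : OpenPartialHomeomorph M LeafModel),
      IsLeafwise (c.symm ≫ₕ f.toOpenPartialHomeomorph ≫ₕ c')
        (c.symm ≫ₕ f.toOpenPartialHomeomorph ≫ₕ c').source ↔
      ∀ q ∈ c.target, f (c.symm q) ∈ c'.source → LeafwiseAt (c' ∘ f ∘ c.symm) q := by
    intro f c c'
    rw [isLeafwise_iff_forall_leafwiseAt (OpenPartialHomeomorph.open_source _)]
    exact ⟨fun h q hq hq' => h q ⟨hq, mem_univ _, hq'⟩, fun h q hq => h q hq.1 hq.2.2⟩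
  have hsymm : ∀ c c' : OpenPartialHomeomorph M LeafModel,
      (c.symm ≫ₕ f.toOpenPartialHomeomorph ≫ₕ c').symm =
        c'.symm ≫ₕ f.symm.toOpenPartialHomeomorph ≫ₕ c := by
    intro c c'
    rw [OpenPartialHomeomorph.trans_symm_eq_symm_trans_symm,
      OpenPartialHomeomorph.trans_symm_eq_symm_trans_symm, OpenPartialHomeomorph.symm_symm,
      OpenPartialHomeomorph.trans_assoc]
    rfl
  have hmem : ∀ c c' : OpenPartialHomeomorph M LeafModel,
      c.symm ≫ₕ f.toOpenPartialHomeomorph ≫ₕ c' ∈ LeafModel.groupoid ↔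
        (∀ q ∈ c.target, f (c.symm q) ∈ c'.source → LeafwiseAt (c' ∘ f ∘ c.symm) q) ∧
        ∀ q ∈ c'.target, f.symm (c'.symm q) ∈ c.source →
          LeafwiseAt (c ∘ f.symm ∘ c'.symm) q := by
    intro c c'
    rw [← hsource f c c', ← hsource f.symm c' c, ← hsymm]
    rfl
  exact ⟨fun h => ⟨fun c hc c' hc' => ((hmem c c').1 (h c hc c' hc')).1,
    fun c hc c' hc' => ((hmem c' c).1 (h c' hc' c hc)).2⟩,
    fun h c hc c' hc' => (hmem c c').2 ⟨h.1 c hc c' hc', h.2 c' hc' c hc⟩⟩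

variable {U : TopologicalSpace.Opens LeafModel}

/-- A self-map of an open subset of `ℂ × [0, ∞)`, extended to all of `ℂ × [0, ∞)` by the identity,
so that it makes sense to ask whether it is leafwise holomorphic at a point. -/
def ambient (g : U → U) : LeafModel → LeafModel :=
  Function.extend Subtype.val (fun p => (g p : LeafModel)) id

theorem ambient_coe (g : U → U) (p : U) : ambient g p = g p :=
  Subtype.val_injective.extend_apply _ _ p

theorem ambient_apply (g : U → U) {p : LeafModel} (hp : p ∈ U) : ambient g p = g ⟨p, hp⟩ :=
  ambient_coe g ⟨p, hp⟩

theorem eventually_nhds_coe_iff {P : LeafModel → Prop} {p : U} :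
    (∀ᶠ q in 𝓝 (p : LeafModel), P q) ↔ ∀ᶠ q : U in 𝓝 p, P q := by
  rw [← U.isOpenEmbedding'.map_nhds_eq, Filter.eventually_map]

/-- A map from an open subset of `ℂ × [0, ∞)` onto `M` whose local sections are the charts of `M`:
a simultaneous parametrization of `M`, unique up to leafwise changes of parameter. -/
structure IsLeafwiseParam (π : U → M) : Prop where
  symm_apply : ∀ c ∈ atlas LeafModel M, ∀ q ∈ c.target, ∃ h : q ∈ U, c.symm q = π ⟨q, h⟩
  leafwiseAt : ∀ c ∈ atlas LeafModel M, ∀ p, π p ∈ c.source →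
    ∃ F, LeafwiseAt F p ∧ ∀ᶠ q in 𝓝 p, c (π q) = F q
  exists_chart : ∀ p, ∃ c ∈ atlas LeafModel M, π p ∈ c.source ∧ ∀ᶠ q : U in 𝓝 p, c (π q) = q

theorem IsLeafwiseParam.isLeafwiseMap_iff {π : U → M} (hπ : IsLeafwiseParam π) {g : U → U}
    (hg : Continuous g) {f : M → M} (hgf : ∀ p, π (g p) = f (π p)) :
    IsLeafwiseMap f ↔ ∀ p : U, LeafwiseAt (ambient g) p := by
  have hread : ∀ c ∈ atlas LeafModel M, ∀ {p : U}, (p : LeafModel) ∈ c.target →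
      f (c.symm p) = π (g p) := by
    intro c hc p hp
    rw [(hπ.symm_apply c hc p hp).2, hgf]
  constructor
  · intro hf p
    obtain ⟨c, hc, hpc, hcπ⟩ := hπ.exists_chart p
    obtain ⟨c', hc', hpc', hc'π⟩ := hπ.exists_chart (g p)
    have hpt : (p : LeafModel) ∈ c.target := hcπ.self_of_nhds ▸ c.map_source hpc
    refine (hf c hc c' hc' p hpt (by rwa [hread c hc hpt])).congr
      (eventually_nhds_coe_iff.2 ?_)
    filter_upwards [eventually_nhds_coe_iff.1 (c.open_target.eventually_mem hpt),
      hg.continuousAt.eventually hc'π] with q hq hq'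
    rw [ambient_coe, Function.comp_apply, Function.comp_apply, hread c hc hq, hq']
  · intro hF c hc c' hc' q hq hq'
    obtain ⟨p, rfl⟩ : ∃ p : U, p = q := ⟨⟨q, (hπ.symm_apply c hc q hq).1⟩, rfl⟩
    rw [hread c hc hq] at hq'
    obtain ⟨F, hFp, hc'π⟩ := hπ.leafwiseAt c' hc' (g p) hq'
    rw [← ambient_coe] at hFp
    refine (hFp.comp (hF p)).congr (eventually_nhds_coe_iff.2 ?_)
    filter_upwards [eventually_nhds_coe_iff.1 (c.open_target.eventually_mem hq),
      hg.continuousAt.eventually hc'π] with r hr hr'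
    simp only [Function.comp_apply]
    rw [hread c hc hr, hr', ambient_coe]

theorem IsLeafwiseParam.mem_leafAut_iff [HasGroupoid M LeafModel.groupoid] {π : U → M}
    (hπ : IsLeafwiseParam π) {g : U ≃ₜ U} {f : M ≃ₜ M} (hgf : ∀ p, π (g p) = f (π p)) :
    f ∈ leafAut M ↔ ∀ p : U, LeafwiseAt (ambient g) p ∧ LeafwiseAt (ambient g.symm) p := by
  have hgf' : ∀ p, π (g.symm p) = f.symm (π p) := fun p => by
    rw [Homeomorph.eq_symm_apply, ← hgf, g.apply_symm_apply]
  rw [_root_.mem_leafAut_iff, hπ.isLeafwiseMap_iff g.continuous hgf,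
    hπ.isLeafwiseMap_iff g.symm.continuous hgf', forall_and]

theorem isLeafwiseParam_id : IsLeafwiseParam (id : U → U) := by
  have hchart : ∀ c ∈ atlas LeafModel U, ∀ p, c p = p := by
    intro c hc p
    obtain ⟨x, hx⟩ := TopologicalSpace.Opens.chart_eq' ⟨p⟩ hc
    rw [hx]
    rfl
  refine ⟨fun c hc q hq => ?_, fun c hc p _ => ⟨id, leafwiseAt_id, .of_forall (hchart c hc)⟩,
    fun p => ⟨chartAt LeafModel p, chart_mem_atlas _ p, mem_chart_source _ p,
      .of_forall (hchart _ (chart_mem_atlas _ p))⟩⟩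
  have hq' : ((c.symm q : U) : LeafModel) = q := by rw [← hchart c hc, c.right_inv hq]
  exact ⟨hq' ▸ (c.symm q).2, Subtype.ext hq'⟩

end Charts

namespace HopfData

variable (D : HopfData)

theorem exists_chart_eq_T_zpow {c : OpenPartialHomeomorph D.Reeb LeafModel}
    (hc : c ∈ atlas LeafModel D.Reeb) {p : hopfCover} (hp : D.proj p ∈ c.source) :
    ∃ n : ℤ, ∀ᶠ q in 𝓝 p, c (D.proj q) = (D.T ^ n) q := by
  obtain ⟨hcp, hproj⟩ := hc _ hp
  obtain ⟨n, hn⟩ := D.proj_eq_iff.1 hproj.symm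
  refine ⟨n, ?_⟩
  obtain ⟨U, hU, hpU, hwander⟩ := D.exists_wandering ⟨c (D.proj p), hcp⟩
  have hcU : ∀ᶠ q in 𝓝 p, c (D.proj q) ∈ Subtype.val '' U :=
    ((c.continuousAt hp).comp D.continuous_proj.continuousAt).eventually_mem
      ((hopfCover.isOpen.isOpenMap_subtype_val _ hU).mem_nhds ⟨_, hpU, rfl⟩)
  have hTU : ∀ᶠ q in 𝓝 p, (D.T ^ n) q ∈ U :=
    (D.T ^ n).1.continuous.continuousAt.eventually_mem (hU.mem_nhds (by rwa [hn]))
  have hsource : ∀ᶠ q in 𝓝 p, D.proj q ∈ c.source :=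
    D.continuous_proj.continuousAt.eventually_mem (c.open_source.mem_nhds hp)
  filter_upwards [hcU, hTU, hsource] with q ⟨r, hr, hrq⟩ hTq hq
  obtain ⟨hcq, hproj⟩ := hc _ hq
  have hrq' : r = ⟨c (D.proj q), hcq⟩ := Subtype.ext hrq
  obtain ⟨m, hm⟩ := D.proj_eq_iff.1 <| show D.proj ((D.T ^ n) q) = D.proj r by
    rw [hrq', hproj, ← D.proj_eq_iff.2 ⟨n, rfl⟩]
  obtain rfl := hwander _ hTq m (by rwa [hm])
  rw [← hrq, ← hm, zpow_zero]
  rfl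

theorem isLeafwiseParam_proj : IsLeafwiseParam D.proj where
  symm_apply c hc q hq := by
    obtain ⟨h, hproj⟩ := hc _ (c.map_target hq)
    have hcq := c.right_inv hq
    exact ⟨hcq ▸ h, hproj.symm.trans (congrArg D.proj (Subtype.ext hcq))⟩
  leafwiseAt c hc p hp := by
    obtain ⟨n, hn⟩ := D.exists_chart_eq_T_zpow hc hp
    refine ⟨_, leafwiseAt_prod ((D.lam, D.phi) ^ n), hn.mono fun q hq => ?_⟩
    rw [hq, D.T_zpow, hopfProd_apply]
  exists_chart p := by
    let c : OpenPartialHomeomorph D.Reeb LeafModel :=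
      D.isLocalHomeomorph_proj.localInverseAt p ≫ₕ
        hopfCover.openPartialHomeomorphSubtypeCoe inferInstance
    have hc : c ∈ atlas LeafModel D.Reeb := fun q hq =>
      ⟨(D.isLocalHomeomorph_proj.localInverseAt p q).2,
        D.isLocalHomeomorph_proj.apply_localInverseAt_of_mem hq.1⟩
    have hp : D.proj p ∈ c.source :=
      ⟨D.isLocalHomeomorph_proj.apply_self_mem_localInverseAt_source, mem_univ _⟩
    refine ⟨c, hc, hp, ?_⟩
    obtain ⟨n, hn⟩ := D.exists_chart_eq_T_zpow hc hp
    obtain ⟨U, -, hpU, hwander⟩ := D.exists_wandering p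
    have hTp : p = (D.T ^ n) p := Subtype.ext <|
      (congrArg Subtype.val D.isLocalHomeomorph_proj.localInverseAt_apply_self.symm).trans
        hn.self_of_nhds
    obtain rfl := hwander p hpU n (hTp ▸ hpU)
    exact hn

theorem mem_leafAut_reeb_iff {f : D.Reeb ≃ₜ D.Reeb} {g : hopfCover ≃ₜ hopfCover}
    (hgf : ∀ p, D.proj (g p) = f (D.proj p)) : f ∈ leafAut D.Reeb ↔ g ∈ leafAut hopfCover :=
  (D.isLeafwiseParam_proj.mem_leafAut_iff hgf).trans
    (isLeafwiseParam_id.mem_leafAut_iff fun _ => rfl).symm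

end HopfData

/-! ### Automorphisms of `R̃` that commute with `T` -/

theorem exists_eq_smul_add_of_linear_growth {E : Type*} [NormedAddCommGroup E] [NormedSpace ℂ E]
    [CompleteSpace E] {f : ℂ → E} (hf : Differentiable ℂ f) {M : ℝ}
    (hM : ∀ z, 1 ≤ ‖z‖ → ‖f z‖ ≤ M * ‖z‖) : ∃ a b : E, ∀ z, f z = z • a + b := by
  have hd : Differentiable ℂ (dslope f 0) := differentiableOn_univ.1 <|
    (Complex.differentiableOn_dslope Filter.univ_mem).2 hf.differentiableOn
  obtain ⟨C, hC⟩ := (isCompact_closedBall (0 : ℂ) 1).exists_bound_of_continuousOn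
    hd.continuous.continuousOn
  have hbound : ∀ z, ‖dslope f 0 z‖ ≤ max C (M + ‖f 0‖) := by
    intro z
    rcases le_total ‖z‖ 1 with hz | hz
    · exact le_max_of_le_left (hC z (mem_closedBall_zero_iff.2 hz))
    · have hz0 : 0 < ‖z‖ := one_pos.trans_le hz
      refine le_max_of_le_right ?_
      rw [dslope_of_ne _ (norm_pos_iff.1 hz0), slope_def_module, sub_zero, norm_smul, norm_inv,
        inv_mul_le_iff₀ hz0]
      calc ‖f z - f 0‖ ≤ ‖f z‖ + ‖f 0‖ := norm_sub_le _ _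
        _ ≤ M * ‖z‖ + ‖z‖ * ‖f 0‖ :=
          add_le_add (hM z hz) (le_mul_of_one_le_left (norm_nonneg _) hz)
        _ = ‖z‖ * (M + ‖f 0‖) := by ring
  obtain ⟨a, ha⟩ := hd.exists_const_forall_eq_of_bounded
    (isBounded_iff_forall_norm_le.2 ⟨_, forall_mem_range.2 hbound⟩)
  refine ⟨a, f 0, fun z => ?_⟩
  rw [← ha z, ← sub_eq_iff_eq_add, ← sub_smul_dslope f 0 z, sub_zero]

theorem DiffHalf.apply_eq_apply_zero_of_contracting {X : Type*} [TopologicalSpace X] [T2Space X]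
    {f : DiffHalf} (hf : ∀ x : ℝ≥0, 0 < x → f x < x) {c : ℝ≥0 → X} (hc : ContinuousAt c 0)
    (hcf : ∀ x, c (f x) = c x) (x : ℝ≥0) : c x = c 0 := by
  have hpow : ∀ n : ℕ, c ((f ^ n) x) = c x := by
    intro n
    induction n with
    | zero => rfl
    | succ n ih => rw [pow_succ_apply, hcf, ih]
  exact tendsto_nhds_unique (tendsto_const_nhds.congr fun n => (hpow n).symm)
    (hc.tendsto.comp (tendsto_pow_apply_of_contracting hf x))

theorem mem_hopfCover_of_fst {z : ℂ} (hz : z ≠ 0) (x : ℝ≥0) : ((z, x) : LeafModel) ∈ hopfCover :=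
  fun h => hz (congrArg Prod.fst h)

theorem mem_hopfCover_of_snd (z : ℂ) {x : ℝ≥0} (hx : x ≠ 0) : ((z, x) : LeafModel) ∈ hopfCover :=
  fun h => hx (congrArg Prod.snd h)

namespace HopfData

variable (D : HopfData)

theorem inv_phi_contracting (x : ℝ≥0) (hx : 0 < x) : D.phi⁻¹ x < x := by
  simpa only [DiffHalf.apply_inv_self] using
    D.expanding (D.phi⁻¹ x) (DiffHalf.apply_pos _ hx)

theorem phi_ne_zero {x : ℝ≥0} (hx : x ≠ 0) : D.phi x ≠ 0 :=
  (DiffHalf.apply_pos D.phi (pos_iff_ne_zero.2 hx)).ne'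

section Equivariant

variable {D} {u : LeafModel → ℂ}
  (hT : ∀ p ∈ hopfCover, u (D.lam * p.1, D.phi p.2) = D.lam * u p)

include hT in
theorem apply_pow_of_equivariant {z : ℂ} (hz : z ≠ 0) (x : ℝ≥0) (n : ℕ) :
    u ((D.lam : ℂ) ^ n * z, (D.phi ^ n) x) = (D.lam : ℂ) ^ n * u (z, x) := by
  induction n with
  | zero => simp only [pow_zero, one_mul]; rfl
  | succ n ih =>
    have hmem := mem_hopfCover_of_fst (mul_ne_zero (pow_ne_zero n D.lam.ne_zero) hz) ((D.phi ^ n) x)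
    rw [DiffHalf.pow_succ_apply, pow_succ', mul_assoc, mul_assoc, ← ih]
    exact hT _ hmem

variable (hu : ContinuousOn u hopfCover)
include hT hu

/-- The powers of `T⁻¹` move the leaf through `x` into the compact fundamental domain
`1 ≤ |z| ≤ |λ|`, over leaves with parameter at most `x`. -/
theorem exists_linear_growth_of_equivariant (x : ℝ≥0) :
    ∃ M : ℝ, ∀ z : ℂ, 1 ≤ ‖z‖ → ‖u (z, x)‖ ≤ M * ‖z‖ := by
  let A : Set LeafModel := (Metric.closedBall 0 ‖(D.lam : ℂ)‖ \ Metric.ball 0 1) ×ˢ Icc 0 x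
  have hA : IsCompact A := ((isCompact_closedBall _ _).diff Metric.isOpen_ball).prod isCompact_Icc
  have hA0 : A ⊆ hopfCover := fun p hp =>
    mem_hopfCover_of_fst (fun h => hp.1.2 (h ▸ Metric.mem_ball_self one_pos)) p.2
  obtain ⟨M, hM⟩ := hA.exists_bound_of_continuousOn (hu.mono hA0)
  refine ⟨M, fun z hz => ?_⟩
  obtain ⟨n, hn, hn'⟩ := exists_nat_pow_near hz D.one_lt_norm
  have hlam : 0 < ‖(D.lam : ℂ)‖ ^ n := pow_pos (one_pos.trans D.one_lt_norm) n
  let w : ℂ := ((D.lam : ℂ) ^ n)⁻¹ * z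
  have hw : ‖w‖ = ‖z‖ / ‖(D.lam : ℂ)‖ ^ n := by
    rw [norm_mul, norm_inv, norm_pow, inv_mul_eq_div]
  have hw1 : 1 ≤ ‖w‖ := by rwa [hw, one_le_div hlam]
  have hwl : ‖w‖ ≤ ‖(D.lam : ℂ)‖ := by
    rw [hw, div_le_iff₀ hlam, ← pow_succ']
    exact hn'.le
  let y : ℝ≥0 := (D.phi⁻¹ ^ n) x
  have hy : y ≤ x :=
    DiffHalf.pow_apply_antitone_of_contracting D.inv_phi_contracting x (Nat.zero_le n)
  have huy : u (z, x) = (D.lam : ℂ) ^ n * u (w, y) := by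
    rw [← apply_pow_of_equivariant hT (norm_pos_iff.1 (one_pos.trans_le hw1)),
      mul_inv_cancel_left₀ (pow_ne_zero n D.lam.ne_zero), ← DiffHalf.mul_apply, inv_pow,
      mul_inv_cancel]
    rfl
  have hMw : ‖u (w, y)‖ ≤ M :=
    hM _ ⟨⟨mem_closedBall_zero_iff.2 hwl, fun h => hw1.not_gt (mem_ball_zero_iff.1 h)⟩,
      zero_le, hy⟩
  calc ‖u (z, x)‖ = ‖(D.lam : ℂ)‖ ^ n * ‖u (w, y)‖ := by rw [huy, norm_mul, norm_pow]
    _ ≤ ‖z‖ * M := by gcongr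
    _ = M * ‖z‖ := mul_comm _ _

omit hT in
theorem continuous_apply_of_continuousOn {z : ℂ} (hz : z ≠ 0) : Continuous fun x => u (z, x) :=
  hu.comp_continuous (by fun_prop) (mem_hopfCover_of_fst hz)

theorem slope_eq_of_equivariant {a b : ℝ≥0 → ℂ}
    (hab : ∀ x, x ≠ 0 → ∀ z, u (z, x) = z • a x + b x) {x : ℝ≥0} (hx : x ≠ 0) :
    a x = u (2, 0) - u (1, 0) := by
  have ha : ∀ x, x ≠ 0 → u (2, x) - u (1, x) = a x := fun x hx => by
    rw [hab x hx, hab x hx]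
    simp only [smul_eq_mul]
    ring
  have hphi : ∀ x, x ≠ 0 → a (D.phi x) = a x := by
    intro x hx
    have h := fun z => hT (z, x) (mem_hopfCover_of_snd z hx)
    simp only [hab _ hx, hab _ (D.phi_ne_zero hx), smul_eq_mul] at h
    exact mul_left_cancel₀ D.lam.ne_zero (by linear_combination h 1 - h 0)
  refine (ha x hx).symm.trans (DiffHalf.apply_eq_apply_zero_of_contracting
    (c := fun x => u (2, x) - u (1, x)) D.inv_phi_contracting
    ((continuous_apply_of_continuousOn hu two_ne_zero).sub
      (continuous_apply_of_continuousOn hu one_ne_zero)).continuousAt (fun x => ?_) x)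
  rcases eq_or_ne x 0 with rfl | hx
  · rw [DiffHalf.apply_zero]
  · have hx' : D.phi⁻¹ x ≠ 0 := (DiffHalf.apply_pos _ (pos_iff_ne_zero.2 hx)).ne'
    rw [ha x hx, ha _ hx', ← hphi _ hx', DiffHalf.apply_inv_self]

theorem exists_eq_mul_add_of_equivariant
    (hhol : ∀ x, x ≠ 0 → Differentiable ℂ fun z => u (z, x)) :
    ∃ a : ℂ, ∀ p ∈ hopfCover, u p = a * p.1 + (u (1, p.2) - a) := by
  have hleaf : ∀ x, ∃ a b : ℂ, x ≠ 0 → ∀ z, u (z, x) = z • a + b := fun x => by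
    by_cases hx : x = 0
    · exact ⟨0, 0, fun h => absurd hx h⟩
    · obtain ⟨M, hM⟩ := exists_linear_growth_of_equivariant hT hu x
      obtain ⟨a, b, hab⟩ := exists_eq_smul_add_of_linear_growth (hhol x hx) hM
      exact ⟨a, b, fun _ => hab⟩
  choose a b hab using hleaf
  let α := u (2, 0) - u (1, 0)
  have hpos : ∀ z x, x ≠ 0 → u (z, x) = α * z + (u (1, x) - α) := fun z x hx => by
    rw [hab x hx, hab x hx 1, slope_eq_of_equivariant hT hu hab hx]
    simp only [smul_eq_mul]
    ring
  refine ⟨α, fun ⟨z, x⟩ hp => ?_⟩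
  rcases eq_or_ne x 0 with rfl | hx
  · have hz : z ≠ 0 := fun h => hp (by rw [h]; rfl)
    exact congrFun (Continuous.ext_on (dense_compl_singleton (0 : ℝ≥0))
      (continuous_apply_of_continuousOn hu hz)
      (((continuous_apply_of_continuousOn hu one_ne_zero).sub continuous_const).const_add (α * z))
      (fun x hx => hpos z x hx)) 0
  · exact hpos z x hx

end Equivariant

end HopfData

namespace LeafModel

variable {F : LeafModel → LeafModel}

theorem snd_eq_of_isPreconnected {s : Set ℂ} (hs : IsPreconnected s) {x : ℝ≥0}
    (hF : ∀ z ∈ s, LeafwiseAt F (z, x)) {z w : ℂ} (hz : z ∈ s) (hw : w ∈ s) :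
    (F (z, x)).2 = (F (w, x)).2 := by
  refine hs.induction₂ (fun z w => (F (z, x)).2 = (F (w, x)).2) (fun z hz => ?_)
    (fun _ _ _ _ _ _ => Eq.trans) (fun _ _ _ _ => Eq.symm) hz hw
  obtain ⟨u, hu, hzu, h⟩ := hF z hz
  obtain ⟨v, hv, hzv, hfol⟩ := h.foliated _ hzu
  have hc : Continuous fun z : ℂ => ((z, x) : LeafModel) := by fun_prop
  filter_upwards [mem_nhdsWithin_of_mem_nhds
    (((hu.inter hv).preimage hc).mem_nhds (show z ∈ _ from ⟨hzu, hzv⟩))] with w hw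
  exact hfol _ ⟨hzu, hzv⟩ _ hw rfl

theorem smoothHalf_of_leafwiseAt {z : ℂ} (h : ∀ x, LeafwiseAt F (z, x)) :
    SmoothHalf fun x => incl (F (z, x)) := by
  intro x hx
  obtain ⟨u, hu, hpu, hF⟩ := h x.toNNReal
  have hincl : ∀ y ∈ Ici (0 : ℝ), incl (z, y.toNNReal) = (z, y) := fun y hy => by
    rw [incl, Real.coe_toNNReal y hy]
  have hsmooth := hF.smooth _ ⟨_, hpu, rfl⟩
  rw [hincl x hx] at hsmooth
  have hslice : ContDiffWithinAt ℝ ∞ (fun y : ℝ => ((z, y) : ℂ × ℝ)) (Ici 0) x :=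
    (contDiff_const.prodMk contDiff_id).contDiffWithinAt
  refine hsmooth.comp_of_preimage_mem_nhdsWithin x hslice ?_
  have hc : Continuous fun y : ℝ => ((z, y.toNNReal) : LeafModel) := by fun_prop
  filter_upwards [self_mem_nhdsWithin, mem_nhdsWithin_of_mem_nhds
    (hc.continuousAt.preimage_mem_nhds (hu.mem_nhds hpu))] with y hy hyu
  exact ⟨_, hyu, hincl y hy⟩

end LeafModel

section CoverAut

theorem leafwiseAt_of_mem_leafAut {U : TopologicalSpace.Opens LeafModel} (g : leafAut U) (p : U) :
    LeafwiseAt (ambient g) p :=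
  ((isLeafwiseParam_id.mem_leafAut_iff fun _ => rfl).1 g.2 p).1

theorem continuousOn_ambient {U : TopologicalSpace.Opens LeafModel} {g : U → U}
    (hg : Continuous g) : ContinuousOn (ambient g) U := by
  rw [continuousOn_iff_continuous_domRestrict]
  exact (continuous_subtype_val.comp hg).congr fun p => (ambient_coe g p).symm

theorem isPreconnected_slice (x : ℝ≥0) :
    IsPreconnected {z : ℂ | ((z, x) : LeafModel) ∈ hopfCover} := by
  rcases eq_or_ne x 0 with rfl | hx
  · have hslice : {z : ℂ | ((z, 0) : LeafModel) ∈ hopfCover} = {0}ᶜ := by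
      ext z
      simp [hopfCover]
    rw [hslice]
    exact (isConnected_compl_singleton_of_one_lt_rank (by simp) 0).isPreconnected
  · have hslice : {z : ℂ | ((z, x) : LeafModel) ∈ hopfCover} = univ :=
      eq_univ_of_forall fun z => mem_hopfCover_of_snd z hx
    rw [hslice]
    exact isPreconnected_univ

theorem snd_apply_eq (g : leafAut hopfCover) {p q : hopfCover} (h : p.1.2 = q.1.2) :
    (g p).1.2 = (g q).1.2 := by
  obtain ⟨⟨z, x⟩, hp⟩ := p
  obtain ⟨⟨w, y⟩, hq⟩ := q
  obtain rfl : x = y := h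
  simpa only [ambient_apply _ hp, ambient_apply _ hq] using
    snd_eq_of_isPreconnected (isPreconnected_slice x)
      (fun z hz => leafwiseAt_of_mem_leafAut g ⟨_, hz⟩) hp hq

/-- The transversal `{1} × [0, ∞)` of `R̃`, which meets every leaf once. -/
def transversal (x : ℝ≥0) : hopfCover := ⟨(1, x), mem_hopfCover_of_fst one_ne_zero x⟩

theorem smoothHalf_transversal (g : leafAut hopfCover) :
    SmoothHalf fun x => incl (g (transversal x)) := by
  have h := smoothHalf_of_leafwiseAt fun x => leafwiseAt_of_mem_leafAut g (transversal x)
  exact h.congr fun x _ => congrArg incl (ambient_coe g (transversal x.toNNReal)).symm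

theorem smoothHalf_snd_transversal (g : leafAut hopfCover) :
    SmoothHalf fun x => ((g (transversal x)).1.2 : ℝ) :=
  contDiff_snd.comp_contDiffOn (smoothHalf_transversal g)

theorem exists_diffHalf_snd (g : leafAut hopfCover) :
    ∃ η : DiffHalf, ∀ p, (g p).1.2 = η p.1.2 := by
  have hinv : ∀ (g : leafAut hopfCover) (x : ℝ≥0),
      (g⁻¹ (transversal (g (transversal x)).1.2)).1.2 = (transversal x).1.2 := fun g x =>
    (snd_apply_eq g⁻¹ (p := transversal (g (transversal x)).1.2) (q := g (transversal x))
      rfl).trans <| congrArg (fun p : hopfCover => p.1.2) (g.1.symm_apply_apply (transversal x))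
  have hcont : ∀ g : leafAut hopfCover, Continuous fun x => (g (transversal x)).1.2 := fun g => by
    have := g.1.continuous
    unfold transversal
    fun_prop
  let η : ℝ≥0 ≃ₜ ℝ≥0 :=
    { toFun := fun x => (g (transversal x)).1.2
      invFun := fun x => (g⁻¹ (transversal x)).1.2
      left_inv := hinv g
      right_inv := hinv g⁻¹
      continuous_toFun := hcont g
      continuous_invFun := hcont g⁻¹ }
  exact ⟨⟨η, smoothHalf_snd_transversal g, smoothHalf_snd_transversal g⁻¹⟩,
    fun p => snd_apply_eq g rfl⟩

end CoverAut

namespace HopfData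

variable (D : HopfData)

theorem T_apply (p : hopfCover) : (D.T p).1 = (D.lam * p.1.1, D.phi p.1.2) := rfl

theorem mem_AutT_iff {g : leafAut hopfCover} : g ∈ D.AutT ↔ ∀ p, g (D.T p) = D.T (g p) := by
  rw [Subgroup.mem_centralizer_singleton_iff, ← Subtype.coe_inj, Homeomorph.ext_iff]
  rfl

theorem mem_Z_iff {η : DiffHalf} : η ∈ D.Z ↔ ∀ x, η (D.phi x) = D.phi (η x) := by
  rw [Subgroup.mem_centralizer_singleton_iff, ← Subtype.coe_inj, Homeomorph.ext_iff]
  rfl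

/-- The transverse parts of `T` and `T⁻¹` are an expansion and a contraction. -/
theorem conj_T_ne_inv (g : leafAut hopfCover) : g.1 * D.T.1 * g.1⁻¹ ≠ D.T.1⁻¹ := by
  intro h
  have h : ∀ p, D.T (g (D.T p)) = g p := fun p =>
    DFunLike.congr_fun (show D.T.1 * (g.1 * D.T.1) = g.1 by
      rw [mul_inv_eq_iff_eq_mul.1 h, mul_inv_cancel_left]) p
  obtain ⟨η, hη⟩ := exists_diffHalf_snd g
  have hlt : η 1 < η (D.phi 1) := DiffHalf.strictMono η (D.expanding 1 one_pos)
  refine (hlt.trans (D.expanding _ (zero_le.trans_lt hlt))).ne' ?_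
  have h1 := congrArg (fun q : hopfCover => q.1.2) (h (transversal 1))
  simp only [T_apply, hη] at h1
  exact h1

theorem exists_fst_eq_mul_add (g : D.AutT) : ∃ a : ℂ, ∀ p : hopfCover,
    (g p).1.1 = a * p.1.1 + ((g (transversal p.1.2)).1.1 - a) := by
  let u : LeafModel → ℂ := fun p => (ambient g p).1
  have hgu : ∀ p : hopfCover, (g p).1.1 = u p := fun p => by simp only [u, ambient_coe]
  have huT : ∀ p ∈ hopfCover, u (D.lam * p.1, D.phi p.2) = D.lam * u p := fun p hp => by
    rw [← hgu ⟨p, hp⟩]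
    exact (hgu (D.T ⟨p, hp⟩)).symm.trans
      (congrArg (fun q : hopfCover => q.1.1) (D.mem_AutT_iff.1 g.2 ⟨p, hp⟩))
  have huhol : ∀ x, x ≠ 0 → Differentiable ℂ fun z => u (z, x) := fun x hx z => by
    obtain ⟨s, -, hs, h⟩ := leafwiseAt_of_mem_leafAut g.1 ⟨_, mem_hopfCover_of_snd z hx⟩
    exact h.holomorphic _ hs
  obtain ⟨a, ha⟩ := exists_eq_mul_add_of_equivariant huT
    (continuous_fst.comp_continuousOn (continuousOn_ambient g.1.1.continuous)) huhol
  refine ⟨a, fun p => ?_⟩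
  rw [hgu, hgu]
  exact ha p p.2

theorem exists_eq_affine (g : D.AutT) :
    ∃ (a : ℂˣ) (η : D.Z) (b : D.K), ∀ p : hopfCover,
      (g p).1 = (a * p.1.1 + (b : ℝ≥0 → ℂ) p.1.2, η.1 p.1.2) := by
  obtain ⟨η, hη⟩ := exists_diffHalf_snd g.1
  obtain ⟨a, ha⟩ := D.exists_fst_eq_mul_add g
  have ha0 : a ≠ 0 := by
    rintro rfl
    have hfst (p : hopfCover) : (g p).1.1 = (g (transversal p.1.2)).1.1 := by
      simpa only [zero_mul, zero_add, sub_zero] using ha p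
    let p : hopfCover := ⟨(2, 1), mem_hopfCover_of_fst two_ne_zero 1⟩
    have h : g (transversal 1) = g p :=
      Subtype.ext (Prod.ext (hfst p).symm (snd_apply_eq g.1 rfl))
    exact OfNat.one_ne_ofNat 2 (congrArg (fun q : hopfCover => q.1.1) (g.1.1.injective h))
  have hT (x : ℝ≥0) := D.mem_AutT_iff.1 g.2 (transversal x)
  have hηZ : η ∈ D.Z := by
    refine D.mem_Z_iff.2 fun x => ?_
    have hx := congrArg (fun q : hopfCover => q.1.2) (hT x)
    simp only [T_apply, hη] at hx
    exact hx
  have hbK : (fun x => (g (transversal x)).1.1 - a) ∈ D.K := by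
    refine ⟨(contDiff_fst.comp_contDiffOn (smoothHalf_transversal g.1)).sub contDiffOn_const,
      fun x => ?_⟩
    have hx : (g (D.T (transversal x))).1.1 = D.lam * (g (transversal x)).1.1 :=
      congrArg (fun q : hopfCover => q.1.1) (hT x)
    have hx' : (g (D.T (transversal x))).1.1 =
        a * (D.lam * 1) + ((g (transversal (D.phi x))).1.1 - a) := ha _
    linear_combination hx - hx'
  exact ⟨Units.mk0 a ha0, ⟨η, hηZ⟩, ⟨_, hbK⟩, fun p => Prod.ext (ha p) (hη p)⟩

/-! ### Passing to the quotient -/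

theorem apply_T_zpow (g : D.AutT) (n : ℤ) (p : hopfCover) :
    g ((D.T ^ n) p) = (D.T ^ n) (g p) := by
  have h : Commute g.1 D.T := Subgroup.mem_centralizer_singleton_iff.1 g.2
  exact congrArg (fun f : leafAut hopfCover => f p) (h.zpow_right n).eq

/-- The map of `R` induced by an automorphism of `R̃` that commutes with `T`. -/
def descendFun (g : D.AutT) : D.Reeb → D.Reeb :=
  Quotient.map g fun p q ⟨n, hn⟩ => ⟨n, by rw [← D.apply_T_zpow, hn]⟩

theorem continuous_descendFun (g : D.AutT) : Continuous (D.descendFun g) :=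
  continuous_quot_lift _ (D.continuous_proj.comp g.1.1.continuous)

theorem descendFun_mul (g h : D.AutT) (q : D.Reeb) :
    D.descendFun (g * h) q = D.descendFun g (D.descendFun h q) := by
  obtain ⟨p, rfl⟩ := D.proj_surjective q
  rfl

theorem descendFun_one (q : D.Reeb) : D.descendFun 1 q = q := by
  obtain ⟨p, rfl⟩ := D.proj_surjective q
  rfl

/-- The homomorphism `Aut(R̃; T) → Aut R` given by passing to the quotient. -/
def descend : D.AutT →* leafAut D.Reeb where
  toFun g :=
    ⟨{ toFun := D.descendFun g
       invFun := D.descendFun g⁻¹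
       left_inv := fun q => by rw [← descendFun_mul, inv_mul_cancel, descendFun_one]
       right_inv := fun q => by rw [← descendFun_mul, mul_inv_cancel, descendFun_one]
       continuous_toFun := D.continuous_descendFun g
       continuous_invFun := D.continuous_descendFun g⁻¹ },
      (D.mem_leafAut_reeb_iff fun _ => rfl).2 g.1.2⟩
  map_one' := Subtype.ext (Homeomorph.ext D.descendFun_one)
  map_mul' g h := Subtype.ext (Homeomorph.ext (D.descendFun_mul g h))

theorem descend_proj (g : D.AutT) (p : hopfCover) : D.descend g (D.proj p) = D.proj (g p) := rfl

theorem descend_eq_iff {g : D.AutT} {f : leafAut D.Reeb} :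
    D.descend g = f ↔ ∀ p, D.proj (g p) = f (D.proj p) := by
  rw [← Subtype.coe_inj, Homeomorph.ext_iff, D.proj_surjective.forall]
  rfl

theorem descend_surjective : Function.Surjective D.descend := by
  intro f
  obtain ⟨g, hg⟩ := D.exists_lift f.1
  have hgA : g ∈ leafAut hopfCover := (D.mem_leafAut_reeb_iff hg).1 f.2
  have hcomm : g * D.T.1 * g⁻¹ = D.T.1 :=
    (D.conj_T_of_lift hg).resolve_right (D.conj_T_ne_inv ⟨g, hgA⟩)
  have hgT : (⟨g, hgA⟩ : leafAut hopfCover) ∈ D.AutT :=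
    Subgroup.mem_centralizer_singleton_iff.2 (Subtype.ext (mul_inv_eq_iff_eq_mul.1 hcomm))
  exact ⟨⟨_, hgT⟩, D.descend_eq_iff.2 hg⟩

theorem ker_descend : D.descend.ker = D.zpowersT := by
  ext g
  have hzpowers : g ∈ D.zpowersT ↔ g.1.1 ∈ Subgroup.zpowers D.T.1 := by
    simp only [Subgroup.mem_zpowers_iff, ← Subtype.coe_inj, SubgroupClass.coe_zpow]
  rw [hzpowers, MonoidHom.mem_ker, D.descend_eq_iff, D.mem_zpowers_T_iff]
  rfl

/-- The isomorphism `Aut(R̃; T) / T^ℤ ≅ Aut R`. -/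
def descendEquiv : (D.AutT ⧸ D.zpowersT) ≃* leafAut D.Reeb :=
  (QuotientGroup.quotientMulEquivOfEq D.ker_descend.symm).trans
    (QuotientGroup.quotientKerEquivOfSurjective D.descend D.descend_surjective)

/-! ### The semidirect product -/

theorem Z_mul_comm (η θ : D.Z) : η * θ = θ * η := by
  have hinv : ∀ η : D.Z, η.1 ∈ Subgroup.centralizer {D.phi⁻¹} := fun η =>
    Subgroup.mem_centralizer_singleton_iff.2
      (Commute.inv_right (Subgroup.mem_centralizer_singleton_iff.1 η.2 : Commute η.1 D.phi)).eq
  have hcomm := DiffHalf.centralizer_mul_comm D.inv_phi_contracting ⟨η.1, hinv η⟩ ⟨θ.1, hinv θ⟩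
  exact Subtype.ext (congrArg (fun k : Subgroup.centralizer {D.phi⁻¹} => k.1) hcomm)

theorem prod_mul_comm (g h : ℂˣ × D.Z) : g * h = h * g :=
  Prod.ext (mul_comm _ _) (D.Z_mul_comm _ _)

/-- The function `a⁻¹ (b ∘ η)`. -/
def twist (g : ℂˣ × D.Z) (b : D.K) : D.K :=
  ⟨fun x => (g.1 : ℂ)⁻¹ * (b : ℝ≥0 → ℂ) (g.2 x),
    contDiffOn_const.mul (SmoothHalf.comp b.2.1 g.2.1.2.1), fun x => by
      change _ * (b : ℝ≥0 → ℂ) (g.2 (D.phi x)) = _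
      rw [D.mem_Z_iff.1 g.2.2, b.2.2, mul_left_comm]⟩

theorem twist_apply (g : ℂˣ × D.Z) (b : D.K) (x : ℝ≥0) :
    (D.twist g b : ℝ≥0 → ℂ) x = (g.1 : ℂ)⁻¹ * (b : ℝ≥0 → ℂ) (g.2 x) := rfl

/-- Composition with `η` is a right action; it is a left action because `Z_φ` is abelian. -/
instance : DistribMulAction (ℂˣ × D.Z) D.K where
  smul := D.twist
  one_smul b := Subtype.ext (funext fun x => (congrArg (· * _) (by simp)).trans (one_mul _))
  mul_smul g h b := Subtype.ext <| funext fun x => by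
    change (D.twist (g * h) b : ℝ≥0 → ℂ) x = (D.twist g (D.twist h b) : ℝ≥0 → ℂ) x
    rw [D.prod_mul_comm g h]
    simp only [twist_apply, Prod.fst_mul, Units.val_mul, mul_inv_rev, mul_assoc]
    rfl
  smul_zero _ := Subtype.ext (funext fun _ => mul_zero _)
  smul_add _ _ _ := Subtype.ext (funext fun _ => mul_add _ _ _)

/-- The action of `ℂ* × Z_φ` on `𝒦`, as a homomorphism. -/
def twistHom : ℂˣ × D.Z →* MulAut (Multiplicative D.K) :=
  (MulAutMultiplicative D.K).symm.toMonoidHom.comp (DistribMulAction.toAddAut _ _)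

theorem twistHom_lam_phi : D.twistHom (D.lam, ⟨D.phi, D.phi_mem⟩) = 1 := by
  refine MulEquiv.ext fun b => congrArg Multiplicative.ofAdd (Subtype.ext (funext fun x => ?_))
  change (D.lam : ℂ)⁻¹ * (b.toAdd : ℝ≥0 → ℂ) (D.phi x) = (b.toAdd : ℝ≥0 → ℂ) x
  rw [b.toAdd.2.2, inv_mul_cancel_left₀ D.lam.ne_zero]

/-- The action of `(ℂ* × Z_φ) / (λ, φ)^ℤ` on `𝒦`. -/
def twistQuot : ((ℂˣ × D.Z) ⧸ D.zpowersLamPhi) →* MulAut (Multiplicative D.K) :=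
  QuotientGroup.lift _ D.twistHom (Subgroup.zpowers_le.2 D.twistHom_lam_phi)

section Translations

variable (b : D.K)

theorem K_zero : (b : ℝ≥0 → ℂ) 0 = 0 := by
  have h := b.2.2 0
  rw [Homeomorph.nnreal_map_zero] at h
  by_contra hb
  have hlam : (D.lam : ℂ) = 1 := mul_right_cancel₀ hb (h.symm.trans (one_mul _).symm)
  exact D.one_lt_norm.ne' (by rw [hlam, norm_one])

theorem K_continuous : Continuous (b : ℝ≥0 → ℂ) := by
  refine (b.2.1.continuousOn.comp_continuous NNReal.continuous_coe fun x => x.2).congr fun x => ?_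
  rw [Function.comp_apply, Real.toNNReal_coe]

theorem translate_mem (p : hopfCover) :
    ((p.1.1 + (b : ℝ≥0 → ℂ) p.1.2, p.1.2) : LeafModel) ∈ hopfCover := by
  rcases eq_or_ne p.1.2 0 with hx | hx
  · refine mem_hopfCover_of_fst (fun h => p.2 (Prod.ext ?_ hx)) _
    rwa [hx, K_zero, add_zero] at h
  · exact mem_hopfCover_of_snd _ hx

/-- The map `(z, x) ↦ (z + b(x), x)`. -/
def translateHomeo : hopfCover ≃ₜ hopfCover where
  toFun p := ⟨(p.1.1 + (b : ℝ≥0 → ℂ) p.1.2, p.1.2), D.translate_mem b p⟩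
  invFun p := ⟨(p.1.1 + ((-b : D.K) : ℝ≥0 → ℂ) p.1.2, p.1.2), D.translate_mem (-b) p⟩
  left_inv p := Subtype.ext (Prod.ext (add_neg_cancel_right _ _) rfl)
  right_inv p := Subtype.ext (Prod.ext (neg_add_cancel_right _ _) rfl)
  continuous_toFun := by
    have := D.K_continuous b
    fun_prop
  continuous_invFun := by
    have := D.K_continuous (-b)
    fun_prop

theorem isLeafwise_translate (s : Set LeafModel) :
    LeafModel.IsLeafwise (fun p => (p.1 + (b : ℝ≥0 → ℂ) p.2, p.2)) s where
  smooth := by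
    have hs : MapsTo Prod.snd (LeafModel.incl '' s) (Ici (0 : ℝ)) := by
      rintro _ ⟨p, -, rfl⟩
      exact p.2.2
    exact (contDiff_fst.contDiffOn.add (ContDiffOn.comp b.2.1 contDiff_snd.contDiffOn hs)).prodMk
      (ContDiffOn.comp (g := fun x : ℝ => (x.toNNReal : ℝ)) smoothHalf_id
        contDiff_snd.contDiffOn hs)
  foliated p _ := ⟨univ, isOpen_univ, mem_univ p, fun _ _ _ _ h => h⟩
  holomorphic p _ := differentiableAt_fun_id.add_const ((b : ℝ≥0 → ℂ) p.2)

theorem translateHomeo_mem : D.translateHomeo b ∈ leafAut hopfCover := by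
  have hleafwise (b : D.K) (p : hopfCover) :
      LeafModel.LeafwiseAt (ambient (D.translateHomeo b)) p :=
    LeafModel.LeafwiseAt.congr ⟨univ, isOpen_univ, mem_univ _, D.isLeafwise_translate b _⟩
      (eventually_nhds_coe_iff.2 (.of_forall (ambient_coe _)))
  exact (isLeafwiseParam_id.mem_leafAut_iff fun _ => rfl).2
    fun p => ⟨hleafwise b p, hleafwise (-b) p⟩

end Translations

variable {D} in
theorem AutT_ext {g h : D.AutT} (hgh : ∀ p, (g p).1 = (h p).1) : g = h :=
  Subtype.ext (Subtype.ext (Homeomorph.ext fun p => Subtype.ext (hgh p)))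

/-- The homomorphism `𝒦 → Aut(R̃; T)` that sends `b` to `(z, x) ↦ (z + b(x), x)`. -/
def translate : Multiplicative D.K →* D.AutT where
  toFun b := ⟨⟨D.translateHomeo b.toAdd, D.translateHomeo_mem _⟩, D.mem_AutT_iff.2 fun p =>
    Subtype.ext <| Prod.ext ((congrArg _ (b.toAdd.2.2 p.1.2)).trans (mul_add _ _ _).symm) rfl⟩
  map_one' := AutT_ext fun _ => Prod.ext (add_zero _) rfl
  map_mul' b c := AutT_ext fun p => Prod.ext
    ((add_assoc p.1.1 ((c.toAdd : ℝ≥0 → ℂ) p.1.2) ((b.toAdd : ℝ≥0 → ℂ) p.1.2)).trans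
      (congrArg _ (add_comm _ _))).symm rfl

theorem translate_apply (b : Multiplicative D.K) (p : hopfCover) :
    (D.translate b p).1 = (p.1.1 + (b.toAdd : ℝ≥0 → ℂ) p.1.2, p.1.2) := rfl

/-- The homomorphism `ℂ* × Z_φ → Aut(R̃; T)` that sends `(a, η)` to `(z, x) ↦ (a z, η(x))`. -/
def diag : ℂˣ × D.Z →* D.AutT where
  toFun g := ⟨⟨hopfProd (g.1, g.2), hopfProd_mem _⟩, D.mem_AutT_iff.2 fun _ =>
    Subtype.ext (Prod.ext (mul_left_comm _ _ _) (D.mem_Z_iff.1 g.2.2 _))⟩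
  map_one' := AutT_ext fun _ => Prod.ext (one_mul _) rfl
  map_mul' _ _ := AutT_ext fun _ => Prod.ext (mul_assoc _ _ _) rfl

theorem diag_apply (g : ℂˣ × D.Z) (p : hopfCover) :
    (D.diag g p).1 = ((g.1 : ℂ) * p.1.1, g.2 p.1.2) := rfl

theorem diag_lam_phi : D.diag (D.lam, ⟨D.phi, D.phi_mem⟩) = ⟨D.T, D.T_mem⟩ := rfl

theorem diag_mul_translate_twist (g : ℂˣ × D.Z) (b : Multiplicative D.K) :
    D.diag g * D.translate (D.twistHom g b) = D.translate b * D.diag g := by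
  refine AutT_ext fun p => Prod.ext ?_ rfl
  change (g.1 : ℂ) * (p.1.1 + (g.1 : ℂ)⁻¹ * _) = (g.1 : ℂ) * p.1.1 + _
  rw [mul_add, mul_inv_cancel_left₀ g.1.ne_zero]
  rfl

/-- The homomorphism `(ℂ* × Z_φ) / (λ, φ)^ℤ → Aut(R̃; T) / T^ℤ` that sends the class of `(a, η)` to
the class of the inverse of `(z, x) ↦ (a z, η(x))`. -/
def diagInvQuot : ((ℂˣ × D.Z) ⧸ D.zpowersLamPhi) →* D.AutT ⧸ D.zpowersT :=
  QuotientGroup.map _ _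
    { toFun := fun g => (D.diag g)⁻¹
      map_one' := by rw [map_one, inv_one]
      map_mul' := fun g h => by rw [D.prod_mul_comm g h, map_mul, mul_inv_rev] }
    (Subgroup.zpowers_le.2 (inv_mem (Subgroup.mem_zpowers _)))

/-- The homomorphism from the semidirect product to `Aut(R̃; T) / T^ℤ`. -/
def semidirectHom :
    Multiplicative D.K ⋊[D.twistQuot] ((ℂˣ × D.Z) ⧸ D.zpowersLamPhi) →* D.AutT ⧸ D.zpowersT :=
  SemidirectProduct.lift ((QuotientGroup.mk' D.zpowersT).comp D.translate) D.diagInvQuot <| by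
    intro q
    obtain ⟨g, rfl⟩ := QuotientGroup.mk_surjective q
    refine MonoidHom.ext fun b => congrArg (QuotientGroup.mk' D.zpowersT) ?_
    change D.translate (D.twistHom g b) = (D.diag g)⁻¹ * D.translate b * (D.diag g)⁻¹⁻¹
    rw [inv_inv, mul_assoc, eq_inv_mul_iff_mul_eq, diag_mul_translate_twist]

theorem semidirectHom_inl (b : Multiplicative D.K) :
    D.semidirectHom (SemidirectProduct.inl b) = (D.translate b : D.AutT ⧸ D.zpowersT) :=
  SemidirectProduct.lift_inl _ _ _ b

theorem semidirectHom_inr (g : ℂˣ × D.Z) :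
    D.semidirectHom (SemidirectProduct.inr (g : (ℂˣ × D.Z) ⧸ D.zpowersLamPhi)) =
      ((D.diag g)⁻¹ : D.AutT) :=
  SemidirectProduct.lift_inr _ _ _ _

theorem exists_eq_diag_mul_translate (g : D.AutT) : ∃ k b, g = D.diag k * D.translate b := by
  obtain ⟨a, η, b, h⟩ := D.exists_eq_affine g
  refine ⟨(a, η), Multiplicative.ofAdd ((a : ℂ)⁻¹ • b), AutT_ext fun p => (h p).trans ?_⟩
  refine Prod.ext (Eq.symm ?_) rfl
  change (a : ℂ) * (p.1.1 + (a : ℂ)⁻¹ * _) = _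
  rw [mul_add, mul_inv_cancel_left₀ a.ne_zero]

theorem semidirectHom_surjective : Function.Surjective D.semidirectHom := by
  intro q
  obtain ⟨g, rfl⟩ := QuotientGroup.mk_surjective q
  obtain ⟨k, b, rfl⟩ := D.exists_eq_diag_mul_translate g
  refine ⟨SemidirectProduct.inr (k : (ℂˣ × D.Z) ⧸ D.zpowersLamPhi)⁻¹ * SemidirectProduct.inl b, ?_⟩
  rw [map_mul, map_inv, map_inv, semidirectHom_inl, semidirectHom_inr, QuotientGroup.mk_mul,
    QuotientGroup.mk_inv, inv_inv]

theorem eq_one_of_translate_eq_diag {b : Multiplicative D.K} {g : ℂˣ × D.Z}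
    (h : D.translate b = D.diag g) : b = 1 ∧ g = 1 := by
  have hp (p : hopfCover) :
      p.1.1 + (b.toAdd : ℝ≥0 → ℂ) p.1.2 = g.1 * p.1.1 ∧ p.1.2 = g.2 p.1.2 := by
    rw [← Prod.mk_inj, ← translate_apply, ← diag_apply, h]
  have h1 (x : ℝ≥0) : 1 + (b.toAdd : ℝ≥0 → ℂ) x = g.1 * 1 := (hp (transversal x)).1
  have h2 (x : ℝ≥0) : 2 + (b.toAdd : ℝ≥0 → ℂ) x = g.1 * 2 :=
    (hp ⟨(2, x), mem_hopfCover_of_fst two_ne_zero x⟩).1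
  have hb : b.toAdd = 0 := Subtype.ext <| funext fun x => show (b.toAdd : ℝ≥0 → ℂ) x = 0 by
    linear_combination 2 * h1 x - h2 x
  have ha : g.1 = 1 := Units.ext <| show (g.1 : ℂ) = 1 by linear_combination h1 0 - h2 0
  have hη : g.2 = 1 :=
    Subtype.ext (Subtype.ext (Homeomorph.ext fun x => (hp (transversal x)).2.symm))
  exact ⟨congrArg Multiplicative.ofAdd hb, Prod.ext ha hη⟩

theorem semidirectHom_injective : Function.Injective D.semidirectHom := by
  rw [injective_iff_map_eq_one]
  rintro ⟨b, q⟩ hs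
  obtain ⟨g, rfl⟩ := QuotientGroup.mk_surjective q
  rw [SemidirectProduct.mk_eq_inl_mul_inr, map_mul, semidirectHom_inl, semidirectHom_inr,
    ← QuotientGroup.mk_mul, QuotientGroup.eq_one_iff, Subgroup.mem_zpowers_iff] at hs
  obtain ⟨n, hn⟩ := hs
  rw [← diag_lam_phi, ← map_zpow, eq_mul_inv_iff_mul_eq, ← map_mul] at hn
  obtain ⟨rfl, hg⟩ := D.eq_one_of_translate_eq_diag hn.symm
  have hgq : (g : (ℂˣ × D.Z) ⧸ D.zpowersLamPhi) = 1 := by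
    rw [QuotientGroup.eq_one_iff, ← inv_mem_iff, ← mul_eq_one_iff_eq_inv.1 hg]
    exact Subgroup.zpow_mem_zpowers _ _
  rw [hgq]
  rfl

/-- The isomorphism of the semidirect product with `Aut R`. -/
def semidirectEquiv :
    Multiplicative D.K ⋊[D.twistQuot] ((ℂˣ × D.Z) ⧸ D.zpowersLamPhi) ≃* leafAut D.Reeb :=
  (MulEquiv.ofBijective D.semidirectHom
    ⟨D.semidirectHom_injective, D.semidirectHom_surjective⟩).trans D.descendEquiv

theorem semidirectEquiv_apply
    (s : Multiplicative D.K ⋊[D.twistQuot] ((ℂˣ × D.Z) ⧸ D.zpowersLamPhi)) :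
    D.semidirectEquiv s = D.descendEquiv (D.semidirectHom s) := rfl

end HopfData

end

theorem theorem3p7 (D : HopfData) :
    -- `Aut(R̃; T) / T^ℤ ≅ Aut R`, by passing to the quotient
    ∃ Φ : (D.AutT ⧸ D.zpowersT) ≃* leafAut D.Reeb,
      (∀ (g : D.AutT) (p : hopfCover), (Φ g : D.Reeb ≃ₜ D.Reeb) (D.proj p) =
        D.proj (((g : leafAut hopfCover) : hopfCover ≃ₜ hopfCover) p)) ∧
    -- the action of `(ℂ* × Z_φ) / (λ, φ)^ℤ` on `𝒦_{λ,φ}`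
    ∃ ρ : ((ℂˣ × D.Z) ⧸ D.zpowersLamPhi) →* MulAut (Multiplicative D.K),
      (∀ (a : ℂˣ) (η : D.Z) (b : D.K) (x : ℝ≥0),
        ((ρ ((a, η) : ℂˣ × D.Z) (Multiplicative.ofAdd b)).toAdd : ℝ≥0 → ℂ) x =
          (a : ℂ)⁻¹ * (b : ℝ≥0 → ℂ) (((η : DiffHalf) : ℝ≥0 ≃ₜ ℝ≥0) x)) ∧
    -- `Aut R` is the semidirect product; `b` corresponds to the translation `(z + b(x), x)`, and
    -- the inverse of `(a, η)` to `(a z, η(x))`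
    ∃ Ψ : leafAut D.Reeb ≃* Multiplicative D.K ⋊[ρ] ((ℂˣ × D.Z) ⧸ D.zpowersLamPhi),
      (∀ b : D.K, ∃ g : D.AutT,
        (∀ p : hopfCover, (((g : leafAut hopfCover) : hopfCover ≃ₜ hopfCover) p : LeafModel) =
          (p.1.1 + (b : ℝ≥0 → ℂ) p.1.2, p.1.2)) ∧
        Ψ (Φ g) = SemidirectProduct.inl (Multiplicative.ofAdd b)) ∧
      (∀ (a : ℂˣ) (η : D.Z), ∃ g : D.AutT,
        (∀ p : hopfCover, (((g : leafAut hopfCover) : hopfCover ≃ₜ hopfCover) p : LeafModel) =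
          ((a : ℂ) * p.1.1, ((η : DiffHalf) : ℝ≥0 ≃ₜ ℝ≥0) p.1.2)) ∧
        Ψ (Φ g) = SemidirectProduct.inr (((a, η) : ℂˣ × D.Z) :
          (ℂˣ × D.Z) ⧸ D.zpowersLamPhi)⁻¹) := by
  refine ⟨D.descendEquiv, D.descend_proj, D.twistQuot, fun a η b x => rfl,
    D.semidirectEquiv.symm, fun b => ⟨D.translate (Multiplicative.ofAdd b), fun p => rfl, ?_⟩,
    fun a η => ⟨D.diag (a, η), fun p => rfl, ?_⟩⟩
  · rw [MulEquiv.symm_apply_eq, D.semidirectEquiv_apply, D.semidirectHom_inl]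
  · rw [MulEquiv.symm_apply_eq, D.semidirectEquiv_apply, ← QuotientGroup.mk_inv,
      D.semidirectHom_inr, map_inv D.diag, inv_inv]
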